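/- **Conventions.** Manifolds are finite-dimensional, Hausdorff, second countable and $C^\infty$. $G$ is a Lie group such that the group $\mathrm{Aut}(G)$ of its Lie group automorphisms, with the smooth structure in which a family $(a_v)_{v\in V}$ is smooth iff $(v,g)\mapsto a_v(g)$ and $(v,g)\mapsto a_v^{-1}(g)$ are smooth, is itself a Lie group. In a groupoid $ab$ is defined when $s(a)=t(b)$. A *Lie 2-groupoid* $\Delta_2\rightrightarrows\Delta_1\rightrightarrows\Delta_0$ is a 2-groupoid on manifolds, with vertical source $l$ and target $u$ from $\Delta_2$ to $\Delta_1$ and compositions $\star$ (vertical) and $*$ (horizontal), such that $\Delta_1\rightrightarrows\Delta_0$, $\Delta_2\rightrightarrows\Delta_1$, $\Delta_2\rightrightarrows\Delta_0$ are Lie groupoids; a Lie groupoid is one with only identity 2-arrows. A *Morita morphism of Lie groupoids* is a smooth functor $f$ with $f_0$ a surjective submersion and $a\mapsto(s(a),f_1(a),t(a))$ a diffeomorphism onto the pullback $\Delta_1[\Gamma_0]=\{(m,a,n): s(a)=f_0(m),\,t(a)=f_0(n)\}$. A *Morita morphism of Lie 2-groupoids* is a smooth strict morphism $\Gamma\to\Delta$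 such that $\Gamma_0\to\Delta_0$ and $\Gamma_1\to\Delta_1[\Gamma_0]$ are surjective submersions and $(\Gamma_2\rightrightarrows\Gamma_1)\to(\Delta_2[\Gamma_0]\rightrightarrows\Delta_1[\Gamma_0])$ is a Morita morphism of Lie groupoids. A *Morita equivalence* is a zigzag of Morita morphisms. A *generalized morphism* is a zigzag of smooth strict morphisms of Lie 2-groupoids whose leftward arrows are Morita morphisms; *equivalence* of generalized morphisms is the weakest equivalence relation that identifies strict morphisms related by a smooth natural 2-transformation, makes each Morita morphism $\phi$ inverse to its reverse $\xleftarrow{\phi}$, and is preserved by pre- and post-composition (concatenation; consecutive forward arrows may be composed). The 2-group $[G\to\mathrm{Aut}(G)]$ is $G\rtimes\mathrm{Aut}(G)\rightrightarrows\mathrm{Aut}(G)\rightrightarrows *$ with $l(g,a)=a$, $u(g,a)=\mathrm{AD}_g\circ a$, $(g',\mathrm{AD}_g\circ a)\star(g,a)=(g'g,a)$, $(g,a)*(h,b)=(g\,a(h),a\circ b)$, where $\mathrm{AD}_g(x)=gxg^{-1}$. For a Lie 2-group $K$, a *principal $K$-bundle* over a Lie groupoid $\Gamma$ is a generalized morphism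 from $\Gamma$ to $K$. Bundles $P:\Gamma\rightsquigarrow K$ and $P':\Gamma'\rightsquigarrow K'$ are *Morita equivalent* if for some Morita equivalences $\mu:\Gamma'\rightsquigarrow\Gamma$ and $\nu:K\rightsquigarrow K'$ the composite of $\mu$, $P$, $\nu$ is equivalent to $P'$. A *Lie groupoid $G$-extension* $\tilde\Gamma\xrightarrow{\phi}\Gamma\rightrightarrows M$ is a short exact sequence $1\to M\times G\xrightarrow{i}\tilde\Gamma\xrightarrow{\phi}\Gamma\to1$ of Lie groupoids over $\mathrm{id}_M$ ($i$ an embedding with image the kernel of $\phi$, $\phi$ a surjective submersion); write $g_m=i(m,g)$. A *homomorphism* of $G$-extensions consists of smooth functors $\tilde f:\tilde\Gamma\to\tilde\Delta$ and $f:\Gamma\to\Delta$ over the same smooth $f_0:M\to N$, commuting with the projections, with $\tilde f(g_m)=(\theta_m(g))_{f_0(m)}$ for some smooth $\theta:M\to\mathrm{Aut}(G)$ (for instance $\theta=1$). It is a *Morita morphism* if $f_0$ is a surjective submersion and $f$, $\tilde f$ are Morita morphisms of Lie groupoids. *Morita equivalence* of $G$-extensions is the equivalence relation generated by Morita morphisms.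 **Proposition.** (a) Let $\tilde\Gamma\xrightarrow{\phi}\Gamma\rightrightarrows M$ be a Lie groupoid $G$-extension. Then the 2-groupoid $\tilde\Gamma\times_\Gamma\tilde\Gamma\rightrightarrows\tilde\Gamma\rightrightarrows M$ with $l(\gamma_1,\gamma_2)=\gamma_2$, $u(\gamma_1,\gamma_2)=\gamma_1$, $(\gamma_1,\gamma_2)\star(\gamma_2,\gamma_3)=(\gamma_1,\gamma_3)$, $(\gamma_1,\gamma_2)*(\delta_1,\delta_2)=(\gamma_1\delta_1,\gamma_2\delta_2)$ is a Lie 2-groupoid, and $$(\Gamma\rightrightarrows M)\longleftarrow(\tilde\Gamma\times_\Gamma\tilde\Gamma\rightrightarrows\tilde\Gamma\rightrightarrows M)\longrightarrow[G\to\mathrm{Aut}(G)]$$ is a principal $[G\to\mathrm{Aut}(G)]$-bundle over $\Gamma\rightrightarrows M$: the left arrow, induced by $\phi$, is a Morita morphism, and the right arrow, given by $\gamma\mapsto\mathrm{AD}_\gamma$ and $(\gamma_1,\gamma_2)\mapsto(g,\mathrm{AD}_{\gamma_2})$, where $(\mathrm{AD}_\gamma x)_{t(\gamma)}=\gamma\,x_{s(\gamma)}\,\gamma^{-1}$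 and $\gamma_1\gamma_2^{-1}=g_{t(\gamma_1)}$, is a smooth morphism of Lie 2-groupoids. (b) If two $G$-extensions are Morita equivalent, then the corresponding $[G\to\mathrm{Aut}(G)]$-bundles are Morita equivalent. The same holds with Morita equivalences understood as invertible arrows: if two $G$-extensions are isomorphic in the localization of the category of $G$-extensions at the Morita morphisms, then, for the corresponding bundles $P:\Gamma\rightsquigarrow K$ and $P':\Gamma'\rightsquigarrow K$ with $K=[G\to\mathrm{Aut}(G)]$, there are generalized morphisms $\mu:\Gamma'\rightsquigarrow\Gamma$ and $\nu:K\rightsquigarrow K$, invertible up to equivalence, such that the composite of $\mu$, $P$, $\nu$ is equivalent to $P'$. -/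

import Mathlib

open Diffeology CategoryTheory Topology
open scoped Manifold ContDiff

universe u

namespace LieTwo

noncomputable section

section Diffeologies

/-- The subspace diffeology. -/
instance instDiffSubtype {X : Type*} [DiffeologicalSpace X] (P : X → Prop) :
    DiffeologicalSpace {x // P x} where
  plots n := {p | IsPlot (fun v => (p v : X))}
  constant_plots _ := isPlot_const
  plot_reparam hp hf := isPlot_reparam hp hf
  locality hp := DiffeologicalSpace.locality fun v => by
    obtain ⟨U, hU, hv, h⟩ := hp v
    exact ⟨U, hU, hv, fun hf hf' => h hf hf'⟩

/-- The product diffeology. -/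
instance instDiffProd {X Y : Type*} [DiffeologicalSpace X] [DiffeologicalSpace Y] :
    DiffeologicalSpace (X × Y) where
  plots n := {p | IsPlot (fun v => (p v).1) ∧ IsPlot (fun v => (p v).2)}
  constant_plots _ := ⟨isPlot_const, isPlot_const⟩
  plot_reparam hp hf := ⟨isPlot_reparam hp.1 hf, isPlot_reparam hp.2 hf⟩
  locality hp := by
    refine ⟨DiffeologicalSpace.locality fun v => ?_, DiffeologicalSpace.locality fun v => ?_⟩
    · obtain ⟨U, hU, hv, h⟩ := hp v
      exact ⟨U, hU, hv, fun hf hf' => (h hf hf').1⟩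
    · obtain ⟨U, hU, hv, h⟩ := hp v
      exact ⟨U, hU, hv, fun hf hf' => (h hf hf').2⟩

/-- The one-point space. -/
instance instDiffPUnit : DiffeologicalSpace PUnit.{u + 1} where
  plots _ := Set.univ
  constant_plots _ := trivial
  plot_reparam _ _ := trivial
  locality _ := trivial

/-- `X` is a smooth manifold: it is identified with a finite-dimensional, boundaryless, Hausdorff
and second countable `C^∞` manifold `N` in such a way that the plots of `X` are exactly the smooth
maps `ℝᵏ → N`. (Sending a manifold to its diffeological space of smooth maps from the `ℝᵏ` is
fully faithful, so this is a property of `X`, and `DSmooth` maps are the usual smooth maps.) -/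
def IsSmoothManifold (X : Type u) [DiffeologicalSpace X] : Prop :=
  ∃ (E : Type) (_ : NormedAddCommGroup E) (_ : NormedSpace ℝ E) (_ : FiniteDimensional ℝ E)
    (N : Type u) (_ : TopologicalSpace N) (_ : ChartedSpace E N) (_ : IsManifold 𝓘(ℝ, E) ∞ N)
    (_ : T2Space N) (_ : SecondCountableTopology N) (e : X ≃ N),
    ∀ (k : ℕ) (p : EuclideanSpace ℝ (Fin k) → X), IsPlot p ↔ ContMDiff (𝓡 k) 𝓘(ℝ, E) ∞ (e ∘ p)

/-- `f` is a surjective submersion: it is smooth and onto, and every smooth family `p` in the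
target, with a point `x` over `p v`, lifts near `v` to a smooth family through `x`. Between
manifolds (take for `p` the inverse of a chart) this is the existence of a smooth local section
through every point of the source, that is, surjectivity of all the differentials. -/
def IsSurjSubmersion {X Y : Type*} [DiffeologicalSpace X] [DiffeologicalSpace Y]
    (f : X → Y) : Prop :=
  DSmooth f ∧ Function.Surjective f ∧
    ∀ (k : ℕ) (p : EuclideanSpace ℝ (Fin k) → Y), IsPlot p →
      ∀ (v : EuclideanSpace ℝ (Fin k)) (x : X), f x = p v →
        ∃ q : EuclideanSpace ℝ (Fin k) → X, IsPlot q ∧ q v = x ∧ ∀ᶠ w in 𝓝 v, f (q w) = p w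

/-- `f` is a diffeomorphism. -/
def IsDiffeo {X Y : Type*} [DiffeologicalSpace X] [DiffeologicalSpace Y] (f : X → Y) : Prop :=
  DSmooth f ∧ ∃ g : Y → X, DSmooth g ∧ Function.LeftInverse g f ∧ Function.RightInverse g f

/-- `f` is a diffeomorphism onto its image with the subspace diffeology. -/
def IsEmbed {X Y : Type*} [DiffeologicalSpace X] [DiffeologicalSpace Y] (f : X → Y) : Prop :=
  Function.Injective f ∧
    ∀ (k : ℕ) (p : EuclideanSpace ℝ (Fin k) → X), IsPlot p ↔ IsPlot (fun v => f (p v))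

theorem isPlot_prodMk {X Y : Type*} [DiffeologicalSpace X] [DiffeologicalSpace Y] {k : ℕ}
    {p : EuclideanSpace ℝ (Fin k) → X} {q : EuclideanSpace ℝ (Fin k) → Y}
    (hp : IsPlot p) (hq : IsPlot q) : IsPlot (fun v => (p v, q v)) := ⟨hp, hq⟩

theorem dSmooth_prodMk {X Y Z : Type*} [DiffeologicalSpace X] [DiffeologicalSpace Y]
    [DiffeologicalSpace Z] {f : Z → X} {g : Z → Y} (hf : DSmooth f) (hg : DSmooth g) :
    DSmooth (fun z => (f z, g z)) := fun k p hp => ⟨hf k p hp, hg k p hp⟩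

theorem dSmooth_fst {X Y : Type*} [DiffeologicalSpace X] [DiffeologicalSpace Y] :
    DSmooth (fun z : X × Y => z.1) := fun _ _ hp => hp.1

theorem dSmooth_snd {X Y : Type*} [DiffeologicalSpace X] [DiffeologicalSpace Y] :
    DSmooth (fun z : X × Y => z.2) := fun _ _ hp => hp.2

end Diffeologies

section LieGroups

/-- `G` is a Lie group (finite-dimensional, Hausdorff, second countable), and its plots are the
smooth maps `ℝᵏ → G`. -/
class IsLieGroup (G : Type u) [Group G] [DiffeologicalSpace G] : Prop where
  exists_lieGroup : ∃ (n : ℕ) (_ : TopologicalSpace G)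
    (_ : ChartedSpace (EuclideanSpace ℝ (Fin n)) G) (_ : LieGroup (𝓡 n) ∞ G)
    (_ : T2Space G) (_ : SecondCountableTopology G),
    ∀ (k : ℕ) (p : EuclideanSpace ℝ (Fin k) → G), IsPlot p ↔ ContMDiff (𝓡 k) (𝓡 n) ∞ p

variable (G : Type u) [Group G] [DiffeologicalSpace G]

/-- The subgroup of the automorphisms of the group `G` that are diffeomorphisms. -/
def lieAutSubgroup : Subgroup (MulAut G) where
  carrier := {e | DSmooth (fun g => e g) ∧ DSmooth (fun g => e⁻¹ g)}
  one_mem' := ⟨dSmooth_id, dSmooth_id⟩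
  mul_mem' := by
    intro a b ha hb
    refine ⟨ha.1.comp hb.1, ?_⟩
    have : DSmooth (fun g => b⁻¹ (a⁻¹ g)) := hb.2.comp ha.2
    rw [mul_inv_rev]
    exact this
  inv_mem' := by
    intro a ha
    refine ⟨ha.2, ?_⟩
    rw [inv_inv]
    exact ha.1

/-- `Aut(G)`: the automorphisms of the Lie group `G`. -/
def LieAut : Type u := lieAutSubgroup G

instance instGroupLieAut : Group (LieAut G) := inferInstanceAs (Group (lieAutSubgroup G))

variable {G} in
/-- Evaluation of an automorphism. -/
def LieAut.ev (e : LieAut G) (g : G) : G := e.1 g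

/-- The smooth structure of `Aut(G)`: a family `p` of automorphisms is smooth when
`(v, g) ↦ p v g` and `(v, g) ↦ (p v)⁻¹ g` are smooth. -/
instance instDiffLieAut : DiffeologicalSpace (LieAut G) where
  plots n := {p |
    DSmooth (fun x : EuclideanSpace ℝ (Fin n) × G => (p x.1).ev x.2) ∧
    DSmooth (fun x : EuclideanSpace ℝ (Fin n) × G => ((p x.1)⁻¹).ev x.2)}
  constant_plots e := ⟨e.2.1.comp dSmooth_snd, e.2.2.comp dSmooth_snd⟩
  plot_reparam {n m p f} hp hf := by
    have hf' : DSmooth f := hf.dSmooth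
    have h : DSmooth (fun x : EuclideanSpace ℝ (Fin n) × G => (f x.1, x.2)) :=
      dSmooth_prodMk (hf'.comp dSmooth_fst) dSmooth_snd
    exact ⟨hp.1.comp h, hp.2.comp h⟩
  locality {n p} hp := by
    constructor
    · intro k q hq
      refine DiffeologicalSpace.locality fun v => ?_
      obtain ⟨U, hU, hv, h⟩ := hp ((q v).1)
      have hc : ContDiff ℝ ∞ (fun w => (q w).1) := (isPlot_iff_contDiff).1 hq.1
      refine ⟨(fun w => (q w).1) ⁻¹' U, hU.preimage hc.continuous, hv, fun {m f} hf hf' => ?_⟩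
      have := (h (f := fun w => (q (f w)).1) hf (hc.comp hf')).1 m (fun w => (w, (q (f w)).2))
        ⟨isPlot_iff_contDiff.2 contDiff_id, isPlot_reparam hq.2 hf'⟩
      exact this
    · intro k q hq
      refine DiffeologicalSpace.locality fun v => ?_
      obtain ⟨U, hU, hv, h⟩ := hp ((q v).1)
      have hc : ContDiff ℝ ∞ (fun w => (q w).1) := (isPlot_iff_contDiff).1 hq.1
      refine ⟨(fun w => (q w).1) ⁻¹' U, hU.preimage hc.continuous, hv, fun {m f} hf hf' => ?_⟩
      have := (h (f := fun w => (q (f w)).1) hf (hc.comp hf')).2 m (fun w => (w, (q (f w)).2))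
        ⟨isPlot_iff_contDiff.2 contDiff_id, isPlot_reparam hq.2 hf'⟩
      exact this

variable {G}

@[simp] theorem LieAut.ev_mul (a b : LieAut G) (g : G) : (a * b).ev g = a.ev (b.ev g) := rfl

@[simp] theorem LieAut.ev_one (g : G) : (1 : LieAut G).ev g = g := rfl

@[simp] theorem LieAut.ev_map_mul (a : LieAut G) (g h : G) : a.ev (g * h) = a.ev g * a.ev h :=
  map_mul a.1 g h

@[simp] theorem LieAut.ev_map_one (a : LieAut G) : a.ev 1 = 1 := map_one a.1

@[simp] theorem LieAut.ev_map_inv (a : LieAut G) (g : G) : a.ev g⁻¹ = (a.ev g)⁻¹ :=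
  map_inv a.1 g

@[simp] theorem LieAut.ev_inv_ev (a : LieAut G) (g : G) : a⁻¹.ev (a.ev g) = g := by
  rw [← LieAut.ev_mul, inv_mul_cancel, LieAut.ev_one]

@[simp] theorem LieAut.ev_ev_inv (a : LieAut G) (g : G) : a.ev (a⁻¹.ev g) = g := by
  rw [← LieAut.ev_mul, mul_inv_cancel, LieAut.ev_one]

theorem LieAut.ext' {a b : LieAut G} (h : ∀ g, a.ev g = b.ev g) : a = b :=
  Subtype.ext (MulEquiv.ext h)

theorem LieAut.dSmooth_mul {X : Type*} [DiffeologicalSpace X] {a b : X → LieAut G}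
    (ha : DSmooth a) (hb : DSmooth b) : DSmooth (fun x => a x * b x) := by
  intro k p hp
  have h1 := ha k p hp
  have h2 := hb k p hp
  constructor
  · exact h1.1.comp (dSmooth_prodMk dSmooth_fst h2.1)
  · have : DSmooth (fun x : EuclideanSpace ℝ (Fin k) × G =>
        ((b (p x.1))⁻¹).ev (((a (p x.1))⁻¹).ev x.2)) :=
      h2.2.comp (dSmooth_prodMk dSmooth_fst h1.2)
    simpa only [Function.comp, mul_inv_rev, LieAut.ev_mul] using this

theorem dSmooth_conj [IsLieGroup G] (g : G) : DSmooth (fun x => MulAut.conj g x) := by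
  obtain ⟨n, _, _, _, _, _, h⟩ := IsLieGroup.exists_lieGroup (G := G)
  intro k p hp
  rw [h] at hp ⊢
  exact (contMDiff_const.mul hp).mul contMDiff_const

/-- The conjugation `AD g : x ↦ g x g⁻¹`. -/
def AD [IsLieGroup G] (g : G) : LieAut G :=
  ⟨MulAut.conj g, dSmooth_conj g, by rw [← map_inv]; exact dSmooth_conj g⁻¹⟩

@[simp] theorem AD_ev [IsLieGroup G] (g x : G) : (AD g).ev x = g * x * g⁻¹ := rfl

end LieGroups

section Groupoids

/-- A groupoid with objects `Ob` and arrows `Ar`; `mul a b` is defined when `s a = t b`. -/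
structure GroupoidStr (Ob Ar : Type u) where
  s : Ar → Ob
  t : Ar → Ob
  one : Ob → Ar
  mul : (a b : Ar) → s a = t b → Ar
  inv : Ar → Ar
  s_one : ∀ m, s (one m) = m
  t_one : ∀ m, t (one m) = m
  s_mul : ∀ a b h, s (mul a b h) = s b
  t_mul : ∀ a b h, t (mul a b h) = t a
  one_mul : ∀ a, mul (one (t a)) a (s_one _) = a
  mul_one : ∀ a, mul a (one (s a)) (t_one _).symm = a
  mul_assoc : ∀ a b c (h : s a = t b) (h' : s b = t c),
    mul (mul a b h) c ((s_mul a b h).trans h') = mul a (mul b c h') (h.trans (t_mul b c h').symm)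
  s_inv : ∀ a, s (inv a) = t a
  t_inv : ∀ a, t (inv a) = s a
  inv_mul : ∀ a, mul (inv a) a (s_inv a) = one (s a)
  mul_inv : ∀ a, mul a (inv a) (t_inv a).symm = one (t a)

namespace GroupoidStr

variable {O A O' A' O'' A'' : Type u}

/-- Functors, given on objects and on arrows. -/
structure IsHom (Γ : GroupoidStr O A) (Δ : GroupoidStr O' A') (f₀ : O → O') (f₁ : A → A') :
    Prop where
  s : ∀ a, Δ.s (f₁ a) = f₀ (Γ.s a)
  t : ∀ a, Δ.t (f₁ a) = f₀ (Γ.t a)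
  one : ∀ m, f₁ (Γ.one m) = Δ.one (f₀ m)
  mul : ∀ a b (h : Γ.s a = Γ.t b), f₁ (Γ.mul a b h) =
    Δ.mul (f₁ a) (f₁ b) ((s a).trans ((congrArg f₀ h).trans (t b).symm))

theorem IsHom.id (Γ : GroupoidStr O A) : Γ.IsHom Γ id id :=
  ⟨fun _ => rfl, fun _ => rfl, fun _ => rfl, fun _ _ _ => rfl⟩

theorem IsHom.comp {Γ : GroupoidStr O A} {Δ : GroupoidStr O' A'} {Λ : GroupoidStr O'' A''}
    {f₀ : O → O'} {f₁ : A → A'} {g₀ : O' → O''} {g₁ : A' → A''}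
    (hf : Γ.IsHom Δ f₀ f₁) (hg : Δ.IsHom Λ g₀ g₁) : Γ.IsHom Λ (g₀ ∘ f₀) (g₁ ∘ f₁) where
  s a := by simp [hf.s, hg.s]
  t a := by simp [hf.t, hg.t]
  one m := by simp [hf.one, hg.one]
  mul a b h := by simp [hf.mul, hg.mul]

/-- The groupoid with only identity arrows. -/
def trivial (A : Type u) : GroupoidStr A A where
  s := id
  t := id
  one := id
  mul a _ _ := a
  inv := id
  s_one _ := rfl
  t_one _ := rfl
  s_mul _ _ h := h
  t_mul _ _ _ := rfl
  one_mul _ := rfl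
  mul_one _ := rfl
  mul_assoc _ _ _ _ _ := rfl
  s_inv _ := rfl
  t_inv _ := rfl
  inv_mul _ := rfl
  mul_inv _ := rfl

/-- Lie groupoids: objects and arrows form manifolds, source and target are surjective submersions,
and the structure maps are smooth. -/
structure IsLie [DiffeologicalSpace O] [DiffeologicalSpace A] (Γ : GroupoidStr O A) : Prop where
  objects : IsSmoothManifold O
  arrows : IsSmoothManifold A
  s : IsSurjSubmersion Γ.s
  t : IsSurjSubmersion Γ.t
  one : DSmooth Γ.one
  mul : DSmooth (fun p : {p : A × A // Γ.s p.1 = Γ.t p.2} => Γ.mul p.1.1 p.1.2 p.2)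
  inv : DSmooth Γ.inv

/-- The arrows `Γ[M] = {(m, a, n) | s a = f m, t a = f n}` of the pullback along `f : M → O`. -/
abbrev Pullback (Γ : GroupoidStr O A) {M : Type u} (f : M → O) : Type u :=
  {x : M × A × M // Γ.s x.2.1 = f x.1 ∧ Γ.t x.2.1 = f x.2.2}

/-- The map `a ↦ (s a, f₁ a, t a)` of a functor into the pullback groupoid. -/
def IsHom.toPullback {Γ : GroupoidStr O A} {Δ : GroupoidStr O' A'} {f₀ : O → O'} {f₁ : A → A'}
    (h : Γ.IsHom Δ f₀ f₁) (a : A) : Δ.Pullback f₀ := ⟨(Γ.s a, f₁ a, Γ.t a), h.s a, h.t a⟩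

/-- Morita morphisms of 1-groupoids: smooth functors that are a surjective submersion on objects
and identify the source with the pullback of the target. -/
structure IsMorita [DiffeologicalSpace O] [DiffeologicalSpace A] [DiffeologicalSpace O']
    [DiffeologicalSpace A'] (Γ : GroupoidStr O A) (Δ : GroupoidStr O' A') (f₀ : O → O')
    (f₁ : A → A') : Prop where
  isHom : Γ.IsHom Δ f₀ f₁
  smooth : DSmooth f₁
  submersion : IsSurjSubmersion f₀
  cartesian : IsDiffeo isHom.toPullback

variable (Γ : GroupoidStr O A)

theorem mul_congr {a a' b b' : A} (ha : a = a') (hb : b = b') (h : Γ.s a = Γ.t b) :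
    Γ.mul a b h = Γ.mul a' b' (by rw [← ha, ← hb]; exact h) := by
  subst ha hb; rfl

theorem mul_right_cancel {a b c : A} (h : Γ.s a = Γ.t c) (h' : Γ.s b = Γ.t c)
    (e : Γ.mul a c h = Γ.mul b c h') : a = b := by
  have key : ∀ (x : A) (hx : Γ.s x = Γ.t c), Γ.mul (Γ.mul x c hx) (Γ.inv c)
      ((Γ.s_mul _ _ _).trans (Γ.t_inv c).symm) = x := by
    intro x hx
    rw [Γ.mul_assoc x c (Γ.inv c) hx (Γ.t_inv c).symm]
    have e1 : Γ.mul c (Γ.inv c) (Γ.t_inv c).symm = Γ.one (Γ.s x) := by rw [Γ.mul_inv, hx]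
    rw [Γ.mul_congr rfl e1]
    exact Γ.mul_one x
  rw [← key a h, ← key b h']
  exact Γ.mul_congr e rfl _

end GroupoidStr

end Groupoids

section TwoGroupoids

/-- A 2-groupoid with objects `O`, 1-arrows `A`, 2-arrows `T`, on spaces with a smooth structure.
`base` is `A ⇉ O`; `vert` is the groupoid `T ⇉ A` of vertical composition, with source `l` and
target `u`; `horiz` is the groupoid `T ⇉ O` of horizontal composition. -/
structure TwoGroupoid where
  O : Type u
  A : Type u
  T : Type u
  [diffO : DiffeologicalSpace O]
  [diffA : DiffeologicalSpace A]
  [diffT : DiffeologicalSpace T]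
  base : GroupoidStr O A
  vert : GroupoidStr A T
  horiz : GroupoidStr O T
  /-- `l` and `u` are functors from `horiz` to `base`. -/
  l_hom : horiz.IsHom base id vert.s
  u_hom : horiz.IsHom base id vert.t
  /-- `a ↦ 1_a` is a functor from `base` to `horiz`. -/
  one_hom : base.IsHom horiz id vert.one
  interchange : ∀ (x y x' y' : T) (h : horiz.s x = horiz.t y) (h' : horiz.s x' = horiz.t y')
    (k : vert.s x = vert.t x') (k' : vert.s y = vert.t y')
    (hk : vert.s (horiz.mul x y h) = vert.t (horiz.mul x' y' h'))
    (kh : horiz.s (vert.mul x x' k) = horiz.t (vert.mul y y' k')),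
    vert.mul (horiz.mul x y h) (horiz.mul x' y' h') hk =
      horiz.mul (vert.mul x x' k) (vert.mul y y' k') kh

attribute [instance] TwoGroupoid.diffO TwoGroupoid.diffA TwoGroupoid.diffT

namespace TwoGroupoid

/-- Lie 2-groupoids. -/
structure IsLie (Γ : TwoGroupoid.{u}) : Prop where
  base : Γ.base.IsLie
  vert : Γ.vert.IsLie
  horiz : Γ.horiz.IsLie

/-- A groupoid seen as a 2-groupoid with only identity 2-arrows. -/
def ofGroupoid {M A : Type u} [DiffeologicalSpace M] [DiffeologicalSpace A]
    (Γ : GroupoidStr M A) : TwoGroupoid.{u} where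
  O := M
  A := A
  T := A
  base := Γ
  vert := GroupoidStr.trivial A
  horiz := Γ
  l_hom := GroupoidStr.IsHom.id Γ
  u_hom := GroupoidStr.IsHom.id Γ
  one_hom := GroupoidStr.IsHom.id Γ
  interchange _ _ _ _ _ _ _ _ _ _ := rfl

/-- Strict morphisms of 2-groupoids. -/
structure Hom (Γ Δ : TwoGroupoid.{u}) where
  f₀ : Γ.O → Δ.O
  f₁ : Γ.A → Δ.A
  f₂ : Γ.T → Δ.T
  base : Γ.base.IsHom Δ.base f₀ f₁
  vert : Γ.vert.IsHom Δ.vert f₁ f₂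
  horiz : Γ.horiz.IsHom Δ.horiz f₀ f₂

/-- Smooth morphisms: the morphisms of Lie 2-groupoids. -/
structure Hom.IsSmooth {Γ Δ : TwoGroupoid.{u}} (f : Hom Γ Δ) : Prop where
  f₀ : DSmooth f.f₀
  f₁ : DSmooth f.f₁
  f₂ : DSmooth f.f₂

/-- The identity morphism. -/
def Hom.id (Γ : TwoGroupoid.{u}) : Hom Γ Γ :=
  ⟨_root_.id, _root_.id, _root_.id, .id _, .id _, .id _⟩

/-- `f` followed by `g`. -/
def Hom.comp {Γ Δ Λ : TwoGroupoid.{u}} (f : Hom Γ Δ) (g : Hom Δ Λ) : Hom Γ Λ :=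
  ⟨g.f₀ ∘ f.f₀, g.f₁ ∘ f.f₁, g.f₂ ∘ f.f₂, f.base.comp g.base, f.vert.comp g.vert,
    f.horiz.comp g.horiz⟩

theorem s_s (Γ : TwoGroupoid.{u}) (x : Γ.T) : Γ.base.s (Γ.vert.s x) = Γ.horiz.s x := Γ.l_hom.s x

theorem t_s (Γ : TwoGroupoid.{u}) (x : Γ.T) : Γ.base.t (Γ.vert.s x) = Γ.horiz.t x := Γ.l_hom.t x

theorem s_t (Γ : TwoGroupoid.{u}) (x : Γ.T) : Γ.base.s (Γ.vert.t x) = Γ.horiz.s x := Γ.u_hom.s x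

theorem t_t (Γ : TwoGroupoid.{u}) (x : Γ.T) : Γ.base.t (Γ.vert.t x) = Γ.horiz.t x := Γ.u_hom.t x

theorem s_vone (Γ : TwoGroupoid.{u}) (a : Γ.A) : Γ.horiz.s (Γ.vert.one a) = Γ.base.s a :=
  Γ.one_hom.s a

theorem t_vone (Γ : TwoGroupoid.{u}) (a : Γ.A) : Γ.horiz.t (Γ.vert.one a) = Γ.base.t a :=
  Γ.one_hom.t a

theorem s_vmul (Γ : TwoGroupoid.{u}) (x y : Γ.T) (h : Γ.vert.s x = Γ.vert.t y) :
    Γ.horiz.s (Γ.vert.mul x y h) = Γ.horiz.s y := by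
  rw [← Γ.s_s, Γ.vert.s_mul, Γ.s_s]

theorem t_vmul (Γ : TwoGroupoid.{u}) (x y : Γ.T) (h : Γ.vert.s x = Γ.vert.t y) :
    Γ.horiz.t (Γ.vert.mul x y h) = Γ.horiz.t x := by
  rw [← Γ.t_t, Γ.vert.t_mul, Γ.t_t]

theorem s_vinv (Γ : TwoGroupoid.{u}) (x : Γ.T) :
    Γ.horiz.s (Γ.vert.inv x) = Γ.horiz.s x := by
  rw [← Γ.s_s, Γ.vert.s_inv, Γ.s_t]

theorem t_vinv (Γ : TwoGroupoid.{u}) (x : Γ.T) :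
    Γ.horiz.t (Γ.vert.inv x) = Γ.horiz.t x := by
  rw [← Γ.t_t, Γ.vert.t_inv, Γ.t_s]

/-- The vertical groupoid `Δ₂[M] ⇉ Δ₁[M]` of the pullback 2-groupoid along `f : M → Δ₀`. -/
def vertPullback (Δ : TwoGroupoid.{u}) {M : Type u} (f : M → Δ.O) :
    GroupoidStr (Δ.base.Pullback f) (Δ.horiz.Pullback f) where
  s x := ⟨(x.1.1, Δ.vert.s x.1.2.1, x.1.2.2),
    (Δ.s_s _).trans x.2.1, (Δ.t_s _).trans x.2.2⟩
  t x := ⟨(x.1.1, Δ.vert.t x.1.2.1, x.1.2.2),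
    (Δ.s_t _).trans x.2.1, (Δ.t_t _).trans x.2.2⟩
  one a := ⟨(a.1.1, Δ.vert.one a.1.2.1, a.1.2.2),
    (Δ.s_vone _).trans a.2.1, (Δ.t_vone _).trans a.2.2⟩
  mul x y h := ⟨(x.1.1, Δ.vert.mul x.1.2.1 y.1.2.1
      (congrArg (fun z : Δ.base.Pullback f => z.1.2.1) h), x.1.2.2), by
    have h1 : x.1.1 = y.1.1 := congrArg (fun z : Δ.base.Pullback f => z.1.1) h
    exact ⟨(Δ.s_vmul _ _ _).trans (y.2.1.trans (congrArg f h1.symm)),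
      (Δ.t_vmul _ _ _).trans x.2.2⟩⟩
  inv x := ⟨(x.1.1, Δ.vert.inv x.1.2.1, x.1.2.2),
    (Δ.s_vinv _).trans x.2.1, (Δ.t_vinv _).trans x.2.2⟩
  s_one a := Subtype.ext (by simp [Δ.vert.s_one])
  t_one a := Subtype.ext (by simp [Δ.vert.t_one])
  s_mul x y h := by
    have h1 : x.1.1 = y.1.1 := congrArg (fun z : Δ.base.Pullback f => z.1.1) h
    have h2 : x.1.2.2 = y.1.2.2 := congrArg (fun z : Δ.base.Pullback f => z.1.2.2) h
    exact Subtype.ext (by simp [Δ.vert.s_mul, h1, h2])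
  t_mul x y h := Subtype.ext (by simp [Δ.vert.t_mul])
  one_mul x := Subtype.ext (by simp [Δ.vert.one_mul])
  mul_one x := Subtype.ext (by simp [Δ.vert.mul_one])
  mul_assoc x y z h h' := Subtype.ext (by simpa using Δ.vert.mul_assoc _ _ _ _ _)
  s_inv x := Subtype.ext (by simp [Δ.vert.s_inv])
  t_inv x := Subtype.ext (by simp [Δ.vert.t_inv])
  inv_mul x := Subtype.ext (by simp [Δ.vert.inv_mul])
  mul_inv x := Subtype.ext (by simp [Δ.vert.mul_inv])

/-- Morita morphisms of Lie 2-groupoids: `Γ₀ → Δ₀` and `Γ₁ → Δ₁[Γ₀]` are surjective submersions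
and `Γ₂ → Δ₂[Γ₀]`, over `Γ₁ → Δ₁[Γ₀]`, is a Morita morphism of 1-groupoids. -/
structure Hom.IsMorita {Γ Δ : TwoGroupoid.{u}} (f : Hom Γ Δ) : Prop where
  smooth : f.IsSmooth
  objects : IsSurjSubmersion f.f₀
  arrows : IsSurjSubmersion f.base.toPullback
  twoArrows : Γ.vert.IsMorita (Δ.vertPullback f.f₀) f.base.toPullback f.horiz.toPullback

/-- Equivalence of two morphisms `f, g : Γ → Δ` by a smooth natural 2-transformation `(φ, ψ)`,
`φ m : f m → g m` and `ψ a : φ (t a) f a ⇒ g a φ (s a)`. The hypotheses on the endpoints in the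
last two clauses only make the compositions meaningful; they all follow from the first two
clauses. -/
def Hom.NatEquiv {Γ Δ : TwoGroupoid.{u}} (f g : Hom Γ Δ) : Prop :=
  ∃ (φ : Γ.O → Δ.A) (ψ : Γ.A → Δ.T), DSmooth φ ∧ DSmooth ψ ∧
    (∀ m, Δ.base.s (φ m) = f.f₀ m ∧ Δ.base.t (φ m) = g.f₀ m) ∧
    (∀ a, (∃ h, Δ.vert.s (ψ a) = Δ.base.mul (φ (Γ.base.t a)) (f.f₁ a) h) ∧
      (∃ h, Δ.vert.t (ψ a) = Δ.base.mul (g.f₁ a) (φ (Γ.base.s a)) h)) ∧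
    (∀ (x : Γ.T) h₁ h₂ h₃ h₄,
      Δ.vert.mul (Δ.horiz.mul (g.f₂ x) (Δ.vert.one (φ (Γ.horiz.s x))) h₁)
        (ψ (Γ.vert.s x)) h₂ =
      Δ.vert.mul (ψ (Γ.vert.t x))
        (Δ.horiz.mul (Δ.vert.one (φ (Γ.horiz.t x))) (f.f₂ x) h₃) h₄) ∧
    (∀ (j i : Γ.A) h h₁ h₂ h₃,
      ψ (Γ.base.mul j i h) =
      Δ.vert.mul (Δ.horiz.mul (Δ.vert.one (g.f₁ j)) (ψ i) h₁)
        (Δ.horiz.mul (ψ j) (Δ.vert.one (f.f₁ i)) h₂) h₃)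

end TwoGroupoid

open TwoGroupoid

/-- Zigzags `Γ ← E₁ → E₂ ← ⋯ → Δ` of morphisms of 2-groupoids. -/
inductive Zigzag : TwoGroupoid.{u} → TwoGroupoid.{u} → Type (u + 1)
  | nil (Γ : TwoGroupoid.{u}) : Zigzag Γ Γ
  | fwd {Γ Δ Λ : TwoGroupoid.{u}} (f : Hom Γ Δ) (z : Zigzag Δ Λ) : Zigzag Γ Λ
  | bwd {Γ Δ Λ : TwoGroupoid.{u}} (f : Hom Δ Γ) (z : Zigzag Δ Λ) : Zigzag Γ Λ

namespace Zigzag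

/-- Concatenation. -/
def append {Γ Δ Λ : TwoGroupoid.{u}} : Zigzag Γ Δ → Zigzag Δ Λ → Zigzag Γ Λ
  | nil _, w => w
  | fwd f z, w => fwd f (append z w)
  | bwd f z, w => bwd f (append z w)

/-- Generalized morphisms: zigzags of morphisms of Lie 2-groupoids all of whose leftward arrows
are Morita morphisms. -/
def IsGenMor : {Γ Δ : TwoGroupoid.{u}} → Zigzag Γ Δ → Prop
  | _, _, nil Γ => Γ.IsLie
  | Γ, _, fwd f z => Γ.IsLie ∧ f.IsSmooth ∧ z.IsGenMor
  | Γ, _, bwd f z => Γ.IsLie ∧ f.IsMorita ∧ z.IsGenMor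

/-- Morita equivalences: zigzags of Morita morphisms of Lie 2-groupoids in either direction. -/
def IsMoritaEquiv : {Γ Δ : TwoGroupoid.{u}} → Zigzag Γ Δ → Prop
  | _, _, nil Γ => Γ.IsLie
  | Γ, _, fwd f z => Γ.IsLie ∧ f.IsMorita ∧ z.IsMoritaEquiv
  | Γ, _, bwd f z => Γ.IsLie ∧ f.IsMorita ∧ z.IsMoritaEquiv

/-- Equivalence of generalized morphisms: the weakest equivalence relation that contains
equivalence of morphisms by natural 2-transformations, makes Morita morphisms invertible, and is
preserved by pre- and post-composition (the composition of morphisms being concatenation). -/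
inductive Equiv : {Γ Δ : TwoGroupoid.{u}} → Zigzag Γ Δ → Zigzag Γ Δ → Prop
  | refl {Γ Δ : TwoGroupoid.{u}} {z : Zigzag Γ Δ} (hz : z.IsGenMor) : Equiv z z
  | symm {Γ Δ : TwoGroupoid.{u}} {z w : Zigzag Γ Δ} : Equiv z w → Equiv w z
  | trans {Γ Δ : TwoGroupoid.{u}} {z w v : Zigzag Γ Δ} : Equiv z w → Equiv w v → Equiv z v
  | id {Γ : TwoGroupoid.{u}} (hΓ : Γ.IsLie) : Equiv (fwd (Hom.id Γ) (nil Γ)) (nil Γ)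
  | comp {Γ Δ Λ : TwoGroupoid.{u}} (hΓ : Γ.IsLie) (hΔ : Δ.IsLie) (hΛ : Λ.IsLie)
      {f : Hom Γ Δ} {g : Hom Δ Λ} (hf : f.IsSmooth) (hg : g.IsSmooth) :
      Equiv (fwd f (fwd g (nil Λ))) (fwd (f.comp g) (nil Λ))
  | natEquiv {Γ Δ : TwoGroupoid.{u}} (hΓ : Γ.IsLie) (hΔ : Δ.IsLie) {f g : Hom Γ Δ}
      (hf : f.IsSmooth) (hg : g.IsSmooth) (h : f.NatEquiv g) :
      Equiv (fwd f (nil Δ)) (fwd g (nil Δ))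
  | bwd_fwd {Γ Δ : TwoGroupoid.{u}} (hΓ : Γ.IsLie) (hΔ : Δ.IsLie) {φ : Hom Γ Δ}
      (hφ : φ.IsMorita) : Equiv (bwd φ (fwd φ (nil Δ))) (nil Δ)
  | fwd_bwd {Γ Δ : TwoGroupoid.{u}} (hΓ : Γ.IsLie) (hΔ : Δ.IsLie) {φ : Hom Γ Δ}
      (hφ : φ.IsMorita) : Equiv (fwd φ (bwd φ (nil Γ))) (nil Γ)
  | precomp {Γ Δ Λ : TwoGroupoid.{u}} {w : Zigzag Γ Δ} (hw : w.IsGenMor) {z z' : Zigzag Δ Λ} :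
      Equiv z z' → Equiv (w.append z) (w.append z')
  | postcomp {Γ Δ Λ : TwoGroupoid.{u}} {z z' : Zigzag Γ Δ} {w : Zigzag Δ Λ} (hw : w.IsGenMor) :
      Equiv z z' → Equiv (z.append w) (z'.append w)

/-- Generalized morphisms that are invertible up to equivalence. -/
def IsInvertible {Γ Δ : TwoGroupoid.{u}} (z : Zigzag Γ Δ) : Prop :=
  z.IsGenMor ∧ ∃ w : Zigzag Δ Γ, w.IsGenMor ∧
    (z.append w).Equiv (nil Γ) ∧ (w.append z).Equiv (nil Δ)

/-- A principal bundle `P : Γ ⇝ K` and a principal bundle `P' : Γ' ⇝ K'` (with `K`, `K'` Lie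
2-groups) are Morita equivalent: for some Morita equivalences `Γ' ⇝ Γ` and `K ⇝ K'`, the composite
`Γ' ⇝ Γ ⇝ K ⇝ K'` is equivalent to `P'`. -/
def BundleMorita {Γ Γ' K K' : TwoGroupoid.{u}} (P : Zigzag Γ K) (P' : Zigzag Γ' K') : Prop :=
  ∃ (μ : Zigzag Γ' Γ) (ν : Zigzag K K'), μ.IsMoritaEquiv ∧ ν.IsMoritaEquiv ∧
    ((μ.append P).append ν).Equiv P'

/-- The same with Morita equivalences understood as invertible generalized morphisms. -/
def BundleMoritaInv {Γ Γ' K K' : TwoGroupoid.{u}} (P : Zigzag Γ K) (P' : Zigzag Γ' K') : Prop :=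
  ∃ (μ : Zigzag Γ' Γ) (ν : Zigzag K K'), μ.IsInvertible ∧ ν.IsInvertible ∧
    ((μ.append P).append ν).Equiv P'

end Zigzag

end TwoGroupoids

section Extensions

variable (G : Type u) [Group G] [DiffeologicalSpace G]

/-- The 2-group `[G → Aut(G)]`, that is `G ⋊ Aut(G) ⇉ Aut(G) ⇉ *`, with `l (g, a) = a`,
`u (g, a) = AD g ∘ a`, `(g', AD g ∘ a) ⋆ (g, a) = (g' g, a)` vertically and
`(g, a) * (h, b) = (g a(h), a ∘ b)` horizontally. -/
def autTwoGroup [IsLieGroup G] : TwoGroupoid.{u} where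
  O := PUnit.{u + 1}
  A := LieAut G
  T := G × LieAut G
  base :=
    { s := fun _ => PUnit.unit
      t := fun _ => PUnit.unit
      one := fun _ => 1
      mul := fun a b _ => a * b
      inv := fun a => a⁻¹
      s_one := fun _ => rfl
      t_one := fun _ => rfl
      s_mul := fun _ _ _ => rfl
      t_mul := fun _ _ _ => rfl
      one_mul := fun a => one_mul a
      mul_one := fun a => mul_one a
      mul_assoc := fun a b c _ _ => mul_assoc a b c
      s_inv := fun _ => rfl
      t_inv := fun _ => rfl
      inv_mul := fun a => inv_mul_cancel a
      mul_inv := fun a => mul_inv_cancel a }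
  vert :=
    { s := fun x => x.2
      t := fun x => AD x.1 * x.2
      one := fun a => (1, a)
      mul := fun x y _ => (x.1 * y.1, y.2)
      inv := fun x => (x.1⁻¹, AD x.1 * x.2)
      s_one := fun _ => rfl
      t_one := fun a => LieAut.ext' fun g => by simp
      s_mul := fun _ _ _ => rfl
      t_mul := fun x y h => LieAut.ext' fun g => by rw [h]; simp [mul_assoc]
      one_mul := fun x => by simp
      mul_one := fun x => by simp
      mul_assoc := fun x y z _ _ => by simp [mul_assoc]
      s_inv := fun _ => rfl
      t_inv := fun x => LieAut.ext' fun g => by simp [mul_assoc]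
      inv_mul := fun x => by simp
      mul_inv := fun x => by simp }
  horiz :=
    { s := fun _ => PUnit.unit
      t := fun _ => PUnit.unit
      one := fun _ => (1, 1)
      mul := fun x y _ => (x.1 * x.2.ev y.1, x.2 * y.2)
      inv := fun x => (x.2⁻¹.ev x.1⁻¹, x.2⁻¹)
      s_one := fun _ => rfl
      t_one := fun _ => rfl
      s_mul := fun _ _ _ => rfl
      t_mul := fun _ _ _ => rfl
      one_mul := fun x => by simp
      mul_one := fun x => by simp
      mul_assoc := fun x y z _ _ => by simp [mul_assoc]
      s_inv := fun _ => rfl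
      t_inv := fun _ => rfl
      inv_mul := fun x => by simp
      mul_inv := fun x => by simp }
  l_hom := ⟨fun _ => rfl, fun _ => rfl, fun _ => rfl, fun _ _ _ => rfl⟩
  u_hom := ⟨fun _ => rfl, fun _ => rfl, fun _ => LieAut.ext' fun g => by simp,
    fun x y _ => LieAut.ext' fun g => by simp [mul_assoc]⟩
  one_hom := ⟨fun _ => rfl, fun _ => rfl, fun _ => rfl, fun a b _ => by simp⟩
  interchange x y x' y' _ _ k k' _ _ := by
    change x.2 = AD x'.1 * x'.2 at k
    refine Prod.ext ?_ rfl
    simp [k, mul_assoc]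

/-- Lie groupoid `G`-extensions: short exact sequences `1 → M × G → Γ̃ → Γ → 1` of Lie groupoids
over the identity of `M`. Here `tot` is `Γ̃ ⇉ M`, `quo` is `Γ ⇉ M`, `φ : Γ̃ → Γ` is the projection
and `i m g` (written `g_m`) is the inclusion. -/
structure LieExt where
  M : Type u
  Tot : Type u
  Quo : Type u
  [diffM : DiffeologicalSpace M]
  [diffTot : DiffeologicalSpace Tot]
  [diffQuo : DiffeologicalSpace Quo]
  tot : GroupoidStr M Tot
  quo : GroupoidStr M Quo
  tot_lie : tot.IsLie
  quo_lie : quo.IsLie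
  φ : Tot → Quo
  φ_hom : tot.IsHom quo id φ
  φ_submersion : IsSurjSubmersion φ
  i : M → G → Tot
  s_i : ∀ m g, tot.s (i m g) = m
  t_i : ∀ m g, tot.t (i m g) = m
  i_mul : ∀ m g h, i m (g * h) = tot.mul (i m g) (i m h) ((s_i m g).trans (t_i m h).symm)
  i_embed : IsEmbed (fun x : M × G => i x.1 x.2)
  exact : ∀ x, (∃ m, φ x = quo.one m) ↔ ∃ m g, i m g = x

attribute [instance] LieExt.diffM LieExt.diffTot LieExt.diffQuo

namespace LieExt

variable {G}

section Adjoint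

variable (X : LieExt G)

theorem i_inj {m m' : X.M} {g g' : G} (h : X.i m g = X.i m' g') : m = m' ∧ g = g' :=
  Prod.ext_iff.1 (X.i_embed.1 (a₁ := (m, g)) (a₂ := (m', g')) h)

theorem i_one (m : X.M) : X.i m 1 = X.tot.one m := by
  have hs : X.tot.s (X.i m 1) = X.tot.t (X.i m 1) := (X.s_i m 1).trans (X.t_i m 1).symm
  refine X.tot.mul_right_cancel (c := X.i m 1) hs ((X.tot.s_one m).trans (X.t_i m 1).symm) ?_
  have h2 : X.tot.mul (X.i m 1) (X.i m 1) hs = X.i m 1 := by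
    rw [← X.i_mul, mul_one]
  rw [h2]
  have h3 := X.tot.one_mul (X.i m 1)
  exact (X.tot.mul_congr (by rw [X.t_i]) rfl _).trans h3 |>.symm

theorem s_φ (x : X.Tot) : X.quo.s (X.φ x) = X.tot.s x := X.φ_hom.s x

theorem t_φ (x : X.Tot) : X.quo.t (X.φ x) = X.tot.t x := X.φ_hom.t x

theorem s_eq_of_φ {x y : X.Tot} (h : X.φ x = X.φ y) : X.tot.s x = X.tot.s y := by
  rw [← X.s_φ, h, X.s_φ]

theorem t_eq_of_φ {x y : X.Tot} (h : X.φ x = X.φ y) : X.tot.t x = X.tot.t y := by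
  rw [← X.t_φ, h, X.t_φ]

theorem φ_i (m : X.M) (g : G) : X.φ (X.i m g) = X.quo.one m := by
  obtain ⟨m', h⟩ := (X.exact _).2 ⟨m, g, rfl⟩
  have : m' = m := by
    have := congrArg X.quo.s h
    rw [X.s_φ, X.s_i, X.quo.s_one] at this
    exact this.symm
  rw [h, this]

theorem φ_inv (x : X.Tot) : X.φ (X.tot.inv x) = X.quo.inv (X.φ x) := by
  refine X.quo.mul_right_cancel (c := X.φ x)
    (by rw [X.s_φ, X.tot.s_inv, X.t_φ]) (X.quo.s_inv _) ?_
  rw [X.quo.inv_mul, ← X.φ_hom.mul _ _ (X.tot.s_inv x), X.tot.inv_mul, X.φ_hom.one, X.s_φ]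
  rfl

/-- `γ · g_{s(γ)} · γ⁻¹`. -/
def conj (γ : X.Tot) (g : G) : X.Tot :=
  X.tot.mul (X.tot.mul γ (X.i (X.tot.s γ) g) (X.t_i _ _).symm) (X.tot.inv γ)
    ((X.tot.s_mul _ _ _).trans ((X.s_i _ _).trans (X.tot.t_inv γ).symm))

/-- `γ₁ · γ₂⁻¹` for `γ₁`, `γ₂` over the same arrow of `Γ`. -/
def quot (γ₁ γ₂ : X.Tot) (h : X.φ γ₁ = X.φ γ₂) : X.Tot :=
  X.tot.mul γ₁ (X.tot.inv γ₂) ((X.s_eq_of_φ h).trans (X.tot.t_inv γ₂).symm)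

theorem exists_quot (γ₁ γ₂ : X.Tot) (h : X.φ γ₁ = X.φ γ₂) :
    ∃ g : G, X.i (X.tot.t γ₁) g = X.quot γ₁ γ₂ h := by
  have h1 : X.φ (X.quot γ₁ γ₂ h) = X.quo.one (X.quo.t (X.φ γ₁)) := by
    unfold quot
    rw [X.φ_hom.mul, ← X.quo.mul_inv]
    exact X.quo.mul_congr rfl (by rw [X.φ_inv, h]) _
  obtain ⟨m, g, hg⟩ := (X.exact _).1 ⟨_, h1⟩
  have : m = X.tot.t γ₁ := by
    rw [← X.t_i m g, hg, quot, X.tot.t_mul]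
  exact ⟨g, this ▸ hg⟩

theorem φ_mul_i (γ : X.Tot) (g : G) :
    X.φ (X.tot.mul γ (X.i (X.tot.s γ) g) (X.t_i _ _).symm) = X.φ γ := by
  rw [X.φ_hom.mul]
  have h := X.quo.mul_one (X.φ γ)
  refine (X.quo.mul_congr rfl ?_ _).trans h
  rw [X.φ_i, X.s_φ]

theorem exists_conj (γ : X.Tot) (g : G) : ∃ g' : G, X.i (X.tot.t γ) g' = X.conj γ g := by
  obtain ⟨g', h⟩ := X.exists_quot _ γ (X.φ_mul_i γ g)
  refine ⟨g', ?_⟩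
  rw [X.tot.t_mul] at h
  exact h

/-- The element `g` of `G` with `γ₁ γ₂⁻¹ = g_{t(γ₁)}`. -/
def diff (γ₁ γ₂ : X.Tot) (h : X.φ γ₁ = X.φ γ₂) : G := (X.exists_quot γ₁ γ₂ h).choose

theorem i_diff (γ₁ γ₂ : X.Tot) (h : X.φ γ₁ = X.φ γ₂) :
    X.i (X.tot.t γ₁) (X.diff γ₁ γ₂ h) = X.quot γ₁ γ₂ h := (X.exists_quot γ₁ γ₂ h).choose_spec

/-- The element `AD_γ g` of `G` with `(AD_γ g)_{t(γ)} = γ · g_{s(γ)} · γ⁻¹`. -/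
def adFun (γ : X.Tot) (g : G) : G := (X.exists_conj γ g).choose

theorem i_adFun (γ : X.Tot) (g : G) : X.i (X.tot.t γ) (X.adFun γ g) = X.conj γ g :=
  (X.exists_conj γ g).choose_spec

theorem mul_inv_mul (a b : X.Tot) (h : X.tot.s a = X.tot.s b)
    (h1 : X.tot.s (X.tot.mul a (X.tot.inv b) (h.trans (X.tot.t_inv b).symm)) = X.tot.t b) :
    X.tot.mul (X.tot.mul a (X.tot.inv b) (h.trans (X.tot.t_inv b).symm)) b h1 = a := by
  rw [X.tot.mul_assoc a (X.tot.inv b) b _ (X.tot.s_inv b)]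
  refine (X.tot.mul_congr rfl ?_ _).trans (X.tot.mul_one a)
  rw [X.tot.inv_mul, h]

/-- `(AD_γ g)_{t(γ)} · γ = γ · g_{s(γ)}`. -/
theorem adFun_mul (γ : X.Tot) (g : G) (h : X.tot.s (X.i (X.tot.t γ) (X.adFun γ g)) = X.tot.t γ) :
    X.tot.mul (X.i (X.tot.t γ) (X.adFun γ g)) γ h =
      X.tot.mul γ (X.i (X.tot.s γ) g) (X.t_i _ _).symm := by
  rw [X.tot.mul_congr (X.i_adFun γ g) rfl h]
  exact X.mul_inv_mul _ _ ((X.tot.s_mul _ _ _).trans (X.s_i _ _)) _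

theorem adFun_unique (γ : X.Tot) (g g' : G) (h : X.tot.s (X.i (X.tot.t γ) g') = X.tot.t γ)
    (e : X.tot.mul (X.i (X.tot.t γ) g') γ h =
      X.tot.mul γ (X.i (X.tot.s γ) g) (X.t_i _ _).symm) : g' = X.adFun γ g := by
  have := X.tot.mul_right_cancel h (X.s_i _ _) (e.trans (X.adFun_mul γ g (X.s_i _ _)).symm)
  exact (X.i_inj this).2

/-- `(γ₁ γ₂⁻¹) · γ₂ = γ₁`. -/
theorem diff_mul (γ₁ γ₂ : X.Tot) (h : X.φ γ₁ = X.φ γ₂)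
    (h1 : X.tot.s (X.i (X.tot.t γ₁) (X.diff γ₁ γ₂ h)) = X.tot.t γ₂) :
    X.tot.mul (X.i (X.tot.t γ₁) (X.diff γ₁ γ₂ h)) γ₂ h1 = γ₁ := by
  rw [X.tot.mul_congr (X.i_diff γ₁ γ₂ h) rfl h1]
  exact X.mul_inv_mul _ _ (X.s_eq_of_φ h) _

theorem diff_unique (γ₁ γ₂ : X.Tot) (h : X.φ γ₁ = X.φ γ₂) (g : G)
    (h1 : X.tot.s (X.i (X.tot.t γ₁) g) = X.tot.t γ₂)
    (e : X.tot.mul (X.i (X.tot.t γ₁) g) γ₂ h1 = γ₁) : g = X.diff γ₁ γ₂ h := by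
  have := X.tot.mul_right_cancel h1 ((X.s_i _ _).trans (X.t_eq_of_φ h))
    (e.trans (X.diff_mul γ₁ γ₂ h _).symm)
  exact (X.i_inj this).2

theorem adFun_one (m : X.M) (g : G) : X.adFun (X.tot.one m) g = g := by
  refine (X.adFun_unique _ _ _ (X.s_i _ _) ?_).symm
  have e1 := X.tot.mul_one (X.i m g)
  have e2 := X.tot.one_mul (X.i m g)
  rw [X.tot.mul_congr (a' := X.i m g) (b' := X.tot.one (X.tot.s (X.i m g)))
      (by rw [X.tot.t_one]) (by rw [X.s_i]), e1,
    X.tot.mul_congr (a' := X.tot.one (X.tot.t (X.i m g))) (b' := X.i m g)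
      (by rw [X.t_i]) (by rw [X.tot.s_one]), e2]

theorem adFun_comp (γ δ : X.Tot) (h : X.tot.s γ = X.tot.t δ) (g : G) :
    X.adFun (X.tot.mul γ δ h) g = X.adFun γ (X.adFun δ g) := by
  refine (X.adFun_unique _ _ _ (X.s_i _ _) ?_).symm
  have hs : X.tot.s (X.i (X.tot.t γ) (X.adFun γ (X.adFun δ g))) = X.tot.t γ := X.s_i _ _
  have hm : X.tot.s γ = X.tot.t (X.i (X.tot.t δ) (X.adFun δ g)) := h.trans (X.t_i _ _).symm
  have hd : X.tot.s (X.i (X.tot.t δ) (X.adFun δ g)) = X.tot.t δ := X.s_i _ _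
  have e1 : X.tot.mul (X.i (X.tot.t γ) (X.adFun γ (X.adFun δ g))) γ hs =
      X.tot.mul γ (X.i (X.tot.t δ) (X.adFun δ g)) hm :=
    (X.adFun_mul γ (X.adFun δ g) hs).trans (X.tot.mul_congr rfl (by rw [h]) _)
  have e2 := X.adFun_mul δ g hd
  calc X.tot.mul (X.i (X.tot.t (X.tot.mul γ δ h)) (X.adFun γ (X.adFun δ g))) (X.tot.mul γ δ h) _
      = X.tot.mul (X.i (X.tot.t γ) (X.adFun γ (X.adFun δ g))) (X.tot.mul γ δ h)
          (hs.trans (X.tot.t_mul _ _ _).symm) := X.tot.mul_congr (by rw [X.tot.t_mul]) rfl _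
    _ = X.tot.mul (X.tot.mul (X.i (X.tot.t γ) (X.adFun γ (X.adFun δ g))) γ hs) δ
          ((X.tot.s_mul _ _ _).trans h) := (X.tot.mul_assoc _ _ _ hs h).symm
    _ = X.tot.mul (X.tot.mul γ (X.i (X.tot.t δ) (X.adFun δ g)) hm) δ
          ((X.tot.s_mul _ _ _).trans hd) := X.tot.mul_congr e1 rfl _
    _ = X.tot.mul γ (X.tot.mul (X.i (X.tot.t δ) (X.adFun δ g)) δ hd)
          (hm.trans (X.tot.t_mul _ _ _).symm) := X.tot.mul_assoc _ _ _ hm hd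
    _ = X.tot.mul γ (X.tot.mul δ (X.i (X.tot.s δ) g) (X.t_i _ _).symm)
          (h.trans (X.tot.t_mul _ _ _).symm) := X.tot.mul_congr rfl e2 _
    _ = X.tot.mul (X.tot.mul γ δ h) (X.i (X.tot.s δ) g)
          ((X.tot.s_mul _ _ _).trans (X.t_i _ _).symm) :=
        (X.tot.mul_assoc _ _ _ h (X.t_i _ _).symm).symm
    _ = _ := X.tot.mul_congr rfl (by rw [X.tot.s_mul]) _

theorem adFun_map_mul (γ : X.Tot) (g g' : G) :
    X.adFun γ (g * g') = X.adFun γ g * X.adFun γ g' := by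
  refine (X.adFun_unique _ _ _ (X.s_i _ _) ?_).symm
  have hs : ∀ a, X.tot.s (X.i (X.tot.t γ) a) = X.tot.t γ := fun a => X.s_i _ _
  have hi : ∀ m (a b : G), X.tot.s (X.i m a) = X.tot.t (X.i m b) :=
    fun m a b => (X.s_i _ _).trans (X.t_i _ _).symm
  have ht : ∀ a, X.tot.s γ = X.tot.t (X.i (X.tot.s γ) a) := fun a => (X.t_i _ _).symm
  calc X.tot.mul (X.i (X.tot.t γ) (X.adFun γ g * X.adFun γ g')) γ _
      = X.tot.mul (X.tot.mul (X.i (X.tot.t γ) (X.adFun γ g)) (X.i (X.tot.t γ) (X.adFun γ g'))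
          (hi _ _ _)) γ ((X.tot.s_mul _ _ _).trans (hs _)) :=
        X.tot.mul_congr (X.i_mul _ _ _) rfl _
    _ = X.tot.mul (X.i (X.tot.t γ) (X.adFun γ g)) (X.tot.mul (X.i (X.tot.t γ) (X.adFun γ g')) γ
          (hs _)) ((hi _ _ _).trans (X.tot.t_mul _ _ _).symm) := X.tot.mul_assoc _ _ _ _ _
    _ = X.tot.mul (X.i (X.tot.t γ) (X.adFun γ g)) (X.tot.mul γ (X.i (X.tot.s γ) g') (ht _))
          ((hs _).trans (X.tot.t_mul _ _ _).symm) :=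
        X.tot.mul_congr rfl (X.adFun_mul γ g' (hs _)) _
    _ = X.tot.mul (X.tot.mul (X.i (X.tot.t γ) (X.adFun γ g)) γ (hs _)) (X.i (X.tot.s γ) g')
          ((X.tot.s_mul _ _ _).trans (ht _)) := (X.tot.mul_assoc _ _ _ _ _).symm
    _ = X.tot.mul (X.tot.mul γ (X.i (X.tot.s γ) g) (ht _)) (X.i (X.tot.s γ) g')
          ((X.tot.s_mul _ _ _).trans (hi _ _ _)) :=
        X.tot.mul_congr (X.adFun_mul γ g (hs _)) rfl _
    _ = X.tot.mul γ (X.tot.mul (X.i (X.tot.s γ) g) (X.i (X.tot.s γ) g') (hi _ _ _))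
          ((ht _).trans (X.tot.t_mul _ _ _).symm) := X.tot.mul_assoc _ _ _ _ _
    _ = _ := X.tot.mul_congr rfl (X.i_mul _ _ _).symm _

theorem adFun_inv_adFun (γ : X.Tot) (g : G) : X.adFun (X.tot.inv γ) (X.adFun γ g) = g := by
  rw [← X.adFun_comp _ _ (X.tot.s_inv γ), X.tot.inv_mul, X.adFun_one]

theorem adFun_adFun_inv (γ : X.Tot) (g : G) : X.adFun γ (X.adFun (X.tot.inv γ) g) = g := by
  rw [← X.adFun_comp _ _ (X.tot.t_inv γ).symm, X.tot.mul_inv, X.adFun_one]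

theorem dSmooth_adFun (γ : X.Tot) : DSmooth (fun g => X.adFun γ g) := by
  intro k p hp
  have hi : ∀ m, IsPlot (fun v => X.i m (p v)) := fun m =>
    (X.i_embed.2 k (fun v => (m, p v))).1 ⟨isPlot_const, hp⟩
  have h1 : IsPlot (fun v => X.tot.mul γ (X.i (X.tot.s γ) (p v)) (X.t_i _ _).symm) :=
    X.tot_lie.mul k (fun v => ⟨(γ, X.i (X.tot.s γ) (p v)), (X.t_i _ _).symm⟩)
      ⟨isPlot_const, hi _⟩
  have h2 : IsPlot (fun v => X.conj γ (p v)) :=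
    X.tot_lie.mul k (fun v => ⟨(X.tot.mul γ (X.i (X.tot.s γ) (p v)) (X.t_i _ _).symm,
      X.tot.inv γ), (X.tot.s_mul _ _ _).trans ((X.s_i _ _).trans (X.tot.t_inv γ).symm)⟩)
      ⟨h1, isPlot_const⟩
  have h3 : IsPlot (fun v => (X.tot.t γ, X.adFun γ (p v))) :=
    (X.i_embed.2 k _).2 (by simpa only [X.i_adFun] using h2)
  exact h3.2

/-- The automorphism `AD_γ` of `G`. -/
def ad (γ : X.Tot) : LieAut G :=
  ⟨{ toFun := X.adFun γ
     invFun := X.adFun (X.tot.inv γ)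
     left_inv := X.adFun_inv_adFun γ
     right_inv := X.adFun_adFun_inv γ
     map_mul' := X.adFun_map_mul γ }, X.dSmooth_adFun γ, X.dSmooth_adFun (X.tot.inv γ)⟩

@[simp] theorem ad_ev (γ : X.Tot) (g : G) : (X.ad γ).ev g = X.adFun γ g := rfl

theorem ad_one (m : X.M) : X.ad (X.tot.one m) = 1 := LieAut.ext' fun g => by simp [X.adFun_one]

theorem ad_mul (γ δ : X.Tot) (h : X.tot.s γ = X.tot.t δ) :
    X.ad (X.tot.mul γ δ h) = X.ad γ * X.ad δ := LieAut.ext' fun g => by simp [X.adFun_comp]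

theorem adFun_i (m : X.M) (g x : G) : X.adFun (X.i m g) x = g * x * g⁻¹ := by
  refine (X.adFun_unique _ _ _ (X.s_i _ _) ?_).symm
  have hi : ∀ m (a b : G), X.tot.s (X.i m a) = X.tot.t (X.i m b) :=
    fun m a b => (X.s_i _ _).trans (X.t_i _ _).symm
  calc X.tot.mul (X.i (X.tot.t (X.i m g)) (g * x * g⁻¹)) (X.i m g) _
      = X.tot.mul (X.i m (g * x * g⁻¹)) (X.i m g) (hi _ _ _) :=
        X.tot.mul_congr (by rw [X.t_i]) rfl _
    _ = X.i m (g * x * g⁻¹ * g) := (X.i_mul _ _ _).symm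
    _ = X.i m (g * x) := by rw [inv_mul_cancel_right]
    _ = X.tot.mul (X.i m g) (X.i m x) (hi _ _ _) := X.i_mul _ _ _
    _ = _ := X.tot.mul_congr rfl (by rw [X.s_i]) _

end Adjoint

/-- The 2-groupoid `Γ̃ ×_Γ Γ̃ ⇉ Γ̃ ⇉ M` of an extension, with `l (γ₁, γ₂) = γ₂`,
`u (γ₁, γ₂) = γ₁`, `(γ₁, γ₂) ⋆ (γ₂, γ₃) = (γ₁, γ₃)` vertically and
`(γ₁, γ₂) * (δ₁, δ₂) = (γ₁ δ₁, γ₂ δ₂)` horizontally. -/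
def twoGroupoid (X : LieExt G) : TwoGroupoid.{u} where
  O := X.M
  A := X.Tot
  T := {p : X.Tot × X.Tot // X.φ p.1 = X.φ p.2}
  base := X.tot
  vert :=
    { s := fun x => x.1.2
      t := fun x => x.1.1
      one := fun γ => ⟨(γ, γ), rfl⟩
      mul := fun x y h => ⟨(x.1.1, y.1.2), x.2.trans ((congrArg X.φ h).trans y.2)⟩
      inv := fun x => ⟨(x.1.2, x.1.1), x.2.symm⟩
      s_one := fun _ => rfl
      t_one := fun _ => rfl
      s_mul := fun _ _ _ => rfl
      t_mul := fun _ _ _ => rfl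
      one_mul := fun _ => rfl
      mul_one := fun _ => rfl
      mul_assoc := fun _ _ _ _ _ => rfl
      s_inv := fun _ => rfl
      t_inv := fun _ => rfl
      inv_mul := fun _ => rfl
      mul_inv := fun _ => rfl }
  horiz :=
    { s := fun x => X.tot.s x.1.2
      t := fun x => X.tot.t x.1.2
      one := fun m => ⟨(X.tot.one m, X.tot.one m), rfl⟩
      mul := fun x y h => ⟨(X.tot.mul x.1.1 y.1.1
          ((X.s_eq_of_φ x.2).trans (h.trans (X.t_eq_of_φ y.2).symm)),
          X.tot.mul x.1.2 y.1.2 h), by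
        rw [X.φ_hom.mul, X.φ_hom.mul]
        exact X.quo.mul_congr x.2 y.2 _⟩
      inv := fun x => ⟨(X.tot.inv x.1.1, X.tot.inv x.1.2), by rw [X.φ_inv, X.φ_inv, x.2]⟩
      s_one := fun _ => X.tot.s_one _
      t_one := fun _ => X.tot.t_one _
      s_mul := fun _ _ _ => X.tot.s_mul _ _ _
      t_mul := fun _ _ _ => X.tot.t_mul _ _ _
      one_mul := fun x => Subtype.ext (Prod.ext
        ((X.tot.mul_congr (by rw [X.t_eq_of_φ x.2]) rfl _).trans (X.tot.one_mul x.1.1))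
        (X.tot.one_mul x.1.2))
      mul_one := fun x => Subtype.ext (Prod.ext
        ((X.tot.mul_congr rfl (by rw [X.s_eq_of_φ x.2]) _).trans (X.tot.mul_one x.1.1))
        (X.tot.mul_one x.1.2))
      mul_assoc := fun _ _ _ _ _ => Subtype.ext (Prod.ext (X.tot.mul_assoc _ _ _ _ _)
        (X.tot.mul_assoc _ _ _ _ _))
      s_inv := fun _ => X.tot.s_inv _
      t_inv := fun _ => X.tot.t_inv _
      inv_mul := fun x => Subtype.ext (Prod.ext
        ((X.tot.inv_mul x.1.1).trans (by rw [X.s_eq_of_φ x.2])) (X.tot.inv_mul x.1.2))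
      mul_inv := fun x => Subtype.ext (Prod.ext
        ((X.tot.mul_inv x.1.1).trans (by rw [X.t_eq_of_φ x.2])) (X.tot.mul_inv x.1.2)) }
  l_hom := ⟨fun _ => rfl, fun _ => rfl, fun _ => rfl, fun _ _ _ => rfl⟩
  u_hom := ⟨fun x => X.s_eq_of_φ x.2, fun x => X.t_eq_of_φ x.2, fun _ => rfl, fun _ _ _ => rfl⟩
  one_hom := ⟨fun _ => rfl, fun _ => rfl, fun _ => rfl, fun _ _ _ => rfl⟩
  interchange _ _ _ _ _ _ _ _ _ _ := rfl

/-- The morphism from `Γ̃ ×_Γ Γ̃ ⇉ Γ̃ ⇉ M` to `Γ ⇉ M` induced by `φ`. -/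
def proj (X : LieExt G) : TwoGroupoid.Hom X.twoGroupoid (TwoGroupoid.ofGroupoid X.quo) where
  f₀ := id
  f₁ := X.φ
  f₂ := fun x => X.φ x.1.2
  base := X.φ_hom
  vert := ⟨fun _ => rfl, fun x => x.2.symm, fun _ => rfl,
    fun _ y h => y.2.symm.trans (congrArg X.φ h).symm⟩
  horiz := ⟨fun x => X.φ_hom.s x.1.2, fun x => X.φ_hom.t x.1.2, fun m => X.φ_hom.one m,
    fun x y h => X.φ_hom.mul x.1.2 y.1.2 h⟩

theorem ad_diff [IsLieGroup G] (X : LieExt G) (γ₁ γ₂ : X.Tot) (h : X.φ γ₁ = X.φ γ₂) :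
    AD (X.diff γ₁ γ₂ h) * X.ad γ₂ = X.ad γ₁ := by
  have e := X.diff_mul γ₁ γ₂ h ((X.s_i _ _).trans (X.t_eq_of_φ h))
  rw [← congrArg X.ad e, X.ad_mul]
  congr 1
  exact LieAut.ext' fun g => by simp [X.adFun_i]

/-- The morphism from `Γ̃ ×_Γ Γ̃ ⇉ Γ̃ ⇉ M` to `[G → Aut(G)]` given by `γ ↦ AD_γ` and
`(γ₁, γ₂) ↦ (g, AD_{γ₂})`, where `γ₁ γ₂⁻¹ = g_{t(γ₁)}`. -/
def adHom [IsLieGroup G] (X : LieExt G) : TwoGroupoid.Hom X.twoGroupoid (autTwoGroup G) where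
  f₀ := fun _ => PUnit.unit
  f₁ := X.ad
  f₂ := fun x => (X.diff x.1.1 x.1.2 x.2, X.ad x.1.2)
  base := ⟨fun _ => rfl, fun _ => rfl, X.ad_one, X.ad_mul⟩
  vert := by
    refine ⟨fun _ => rfl, fun x => X.ad_diff _ _ x.2, fun γ => ?_, fun x y h => ?_⟩
    · refine Prod.ext (X.diff_unique _ _ _ _ (X.s_i _ _) ?_).symm rfl
      exact (X.tot.mul_congr (X.i_one _) rfl _).trans (X.tot.one_mul γ)
    · obtain ⟨⟨a, b⟩, hab⟩ := x
      obtain ⟨⟨b', c⟩, hbc⟩ := y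
      change b = b' at h
      subst h
      change X.φ a = X.φ b at hab
      change X.φ b = X.φ c at hbc
      refine Prod.ext (X.diff_unique a c _ _ ((X.s_i _ _).trans
        ((X.t_eq_of_φ hab).trans (X.t_eq_of_φ hbc))) ?_).symm rfl
      have e1 := X.diff_mul a b hab ((X.s_i _ _).trans (X.t_eq_of_φ hab))
      have e2 := X.diff_mul b c hbc ((X.s_i _ _).trans (X.t_eq_of_φ hbc))
      have ht : X.tot.t a = X.tot.t b := X.t_eq_of_φ hab
      have ht' : X.tot.t b = X.tot.t c := X.t_eq_of_φ hbc
      have hi : ∀ m (a b : G), X.tot.s (X.i m a) = X.tot.t (X.i m b) :=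
        fun m a b => (X.s_i _ _).trans (X.t_i _ _).symm
      calc X.tot.mul (X.i (X.tot.t a) (X.diff a b hab * X.diff b c hbc)) c _
          = X.tot.mul (X.tot.mul (X.i (X.tot.t a) (X.diff a b hab))
              (X.i (X.tot.t a) (X.diff b c hbc)) (hi _ _ _)) c
              ((X.tot.s_mul _ _ _).trans ((X.s_i _ _).trans (ht.trans ht'))) :=
            X.tot.mul_congr (X.i_mul _ _ _) rfl _
        _ = X.tot.mul (X.i (X.tot.t a) (X.diff a b hab))
              (X.tot.mul (X.i (X.tot.t a) (X.diff b c hbc)) c ((X.s_i _ _).trans (ht.trans ht')))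
              ((hi _ _ _).trans (X.tot.t_mul _ _ _).symm) := X.tot.mul_assoc _ _ _ _ _
        _ = X.tot.mul (X.i (X.tot.t a) (X.diff a b hab)) b ((X.s_i _ _).trans ht) := by
            refine X.tot.mul_congr rfl (Eq.trans ?_ e2) _
            exact X.tot.mul_congr (by rw [ht]) rfl _
        _ = a := e1
  horiz := by
    refine ⟨fun _ => rfl, fun _ => rfl, fun m => ?_, fun x y h => ?_⟩
    · refine Prod.ext (X.diff_unique _ _ _ _ (X.s_i _ _) ?_).symm (X.ad_one m)
      exact (X.tot.mul_congr (X.i_one _) rfl _).trans (X.tot.one_mul _)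
    · obtain ⟨⟨a, b⟩, hab⟩ := x
      obtain ⟨⟨c, d⟩, hcd⟩ := y
      change X.φ a = X.φ b at hab
      change X.φ c = X.φ d at hcd
      change X.tot.s b = X.tot.t d at h
      have hac : X.tot.s a = X.tot.t c :=
        (X.s_eq_of_φ hab).trans (h.trans (X.t_eq_of_φ hcd).symm)
      have hab' : X.φ (X.tot.mul a c hac) = X.φ (X.tot.mul b d h) := by
        rw [X.φ_hom.mul, X.φ_hom.mul]
        exact X.quo.mul_congr hab hcd _
      have hta : X.tot.t a = X.tot.t b := X.t_eq_of_φ hab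
      have htc : X.tot.t c = X.tot.t d := X.t_eq_of_φ hcd
      refine Prod.ext (X.diff_unique (X.tot.mul a c hac) (X.tot.mul b d h) hab' _
        ((X.s_i _ _).trans (X.t_eq_of_φ hab')) ?_).symm (X.ad_mul b d h)
      have hi : ∀ m (a b : G), X.tot.s (X.i m a) = X.tot.t (X.i m b) :=
        fun m a b => (X.s_i _ _).trans (X.t_i _ _).symm
      have e1 := X.diff_mul a b hab ((X.s_i _ _).trans hta)
      have e2 := X.diff_mul c d hcd ((X.s_i _ _).trans htc)
      change X.tot.mul (X.i (X.tot.t (X.tot.mul a c hac))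
        (X.diff a b hab * X.adFun b (X.diff c d hcd))) (X.tot.mul b d h) _ = X.tot.mul a c hac
      have e3 := X.adFun_mul b (X.diff c d hcd) (X.s_i _ _)
      have hb : X.tot.s (X.i (X.tot.t b) (X.diff a b hab)) = X.tot.t b := X.s_i _ _
      have hb' : X.tot.s (X.i (X.tot.t b) (X.adFun b (X.diff c d hcd))) = X.tot.t b := X.s_i _ _
      have hc' : X.tot.s b = X.tot.t (X.i (X.tot.s b) (X.diff c d hcd)) := (X.t_i _ _).symm
      have hd' : X.tot.s (X.i (X.tot.s b) (X.diff c d hcd)) = X.tot.t d := (X.s_i _ _).trans h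
      have e1' : X.tot.mul (X.i (X.tot.t b) (X.diff a b hab)) b hb = a :=
        (X.tot.mul_congr (by rw [hta]) rfl _).trans e1
      have e2' : X.tot.mul (X.i (X.tot.s b) (X.diff c d hcd)) d hd' = c :=
        (X.tot.mul_congr (by rw [h, htc]) rfl _).trans e2
      calc X.tot.mul (X.i (X.tot.t (X.tot.mul a c hac))
            (X.diff a b hab * X.adFun b (X.diff c d hcd))) (X.tot.mul b d h) _
          = X.tot.mul (X.tot.mul (X.i (X.tot.t b) (X.diff a b hab))
              (X.i (X.tot.t b) (X.adFun b (X.diff c d hcd))) (hi _ _ _)) (X.tot.mul b d h)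
              ((X.tot.s_mul _ _ _).trans (hb'.trans (X.tot.t_mul _ _ _).symm)) :=
            X.tot.mul_congr (by rw [X.tot.t_mul, hta, X.i_mul]) rfl _
        _ = X.tot.mul (X.i (X.tot.t b) (X.diff a b hab))
              (X.tot.mul (X.i (X.tot.t b) (X.adFun b (X.diff c d hcd))) (X.tot.mul b d h)
                (hb'.trans (X.tot.t_mul _ _ _).symm))
              ((hi _ _ _).trans (X.tot.t_mul _ _ _).symm) := X.tot.mul_assoc _ _ _ _ _
        _ = X.tot.mul (X.i (X.tot.t b) (X.diff a b hab))
              (X.tot.mul b c (h.trans htc.symm))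
              (hb.trans (X.tot.t_mul _ _ _).symm) := by
            refine X.tot.mul_congr rfl ?_ _
            rw [← X.tot.mul_assoc _ b d hb' h, X.tot.mul_congr e3 rfl,
              X.tot.mul_assoc _ _ _ hc' hd']
            exact X.tot.mul_congr rfl e2' _
        _ = X.tot.mul (X.tot.mul (X.i (X.tot.t b) (X.diff a b hab)) b hb) c
              ((X.tot.s_mul _ _ _).trans (h.trans htc.symm)) :=
            (X.tot.mul_assoc _ _ _ _ _).symm
        _ = X.tot.mul a c hac := X.tot.mul_congr e1' rfl _

/-- The zigzag `(Γ ⇉ M) ← (Γ̃ ×_Γ Γ̃ ⇉ Γ̃ ⇉ M) → [G → Aut(G)]` of an extension. -/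
def bundle [IsLieGroup G] (X : LieExt G) : Zigzag (TwoGroupoid.ofGroupoid X.quo) (autTwoGroup G) :=
  .bwd X.proj (.fwd X.adHom (.nil _))

/-- Homomorphisms of `G`-extensions: smooth functors `Γ̃ → Δ̃` and `Γ → Δ` over a smooth map
`M → N`, compatible with the projections, which map the kernels to each other by a smooth family
`θ` of automorphisms of `G`: `g_m ↦ (θ_m g)_{f m}`. -/
@[ext]
structure Hom (X Y : LieExt G) where
  f₀ : X.M → Y.M
  fTot : X.Tot → Y.Tot
  fQuo : X.Quo → Y.Quo
  smooth₀ : DSmooth f₀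
  smoothTot : DSmooth fTot
  smoothQuo : DSmooth fQuo
  homTot : X.tot.IsHom Y.tot f₀ fTot
  homQuo : X.quo.IsHom Y.quo f₀ fQuo
  comm : ∀ x, Y.φ (fTot x) = fQuo (X.φ x)
  kernel : ∃ θ : X.M → LieAut G, DSmooth θ ∧ ∀ m g, fTot (X.i m g) = Y.i (f₀ m) ((θ m).ev g)

/-- The category of Lie groupoid `G`-extensions. -/
instance : Category (LieExt G) where
  Hom := Hom
  id X := ⟨id, id, id, dSmooth_id, dSmooth_id, dSmooth_id, .id _, .id _, fun _ => rfl,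
    fun _ => 1, dSmooth_const, fun _ _ => rfl⟩
  comp {X Y Z} f g := ⟨g.f₀ ∘ f.f₀, g.fTot ∘ f.fTot, g.fQuo ∘ f.fQuo, g.smooth₀.comp f.smooth₀,
    g.smoothTot.comp f.smoothTot, g.smoothQuo.comp f.smoothQuo, f.homTot.comp g.homTot,
    f.homQuo.comp g.homQuo, fun x => by simp [f.comm, g.comm], by
      obtain ⟨θ, hθ, h⟩ := f.kernel
      obtain ⟨η, hη, k⟩ := g.kernel
      exact ⟨fun m => η (f.f₀ m) * θ m, LieAut.dSmooth_mul (hη.comp f.smooth₀) hθ,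
        fun m x => by simp [h, k]⟩⟩

/-- Morita morphisms of `G`-extensions. -/
def morita (G : Type u) [Group G] [DiffeologicalSpace G] : MorphismProperty (LieExt G) :=
  fun X Y f => IsSurjSubmersion f.f₀ ∧ X.quo.IsMorita Y.quo f.f₀ f.fQuo ∧
    X.tot.IsMorita Y.tot f.f₀ f.fTot

/-- The equivalence relation on `G`-extensions generated by the Morita morphisms. -/
def MoritaEquiv (X Y : LieExt G) : Prop :=
  Relation.EqvGen (fun X Y : LieExt G => ∃ f : X ⟶ Y, morita G f) X Y

/-- Two `G`-extensions are isomorphic in the localization of the category of `G`-extensions at the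
Morita morphisms. -/
def LocIso (X Y : LieExt G) : Prop :=
  Nonempty ((morita G).Q.obj X ≅ (morita G).Q.obj Y)

end LieExt

end Extensions

end

end LieTwo

/-! For part (a), everything rests on the diffeomorphism `isDiffeo_diff` from Γ̃ ×_Γ Γ̃ to G × Γ̃,
(γ₁, γ₂) ↦ (γ₁γ₂⁻¹, γ₂). It makes the space of 2-arrows a manifold and turns l into a projection,
while u is l after the swap; hence `isLie_twoGroupoid`. The projection to Γ is Morita because φ is a
surjective submersion and a 2-arrow is exactly a pair of arrows of Γ̃ with the same image
(`isMorita_proj`). The maps AD_γ and γ₁γ₂⁻¹ are smooth because multiplication in Γ̃ is smooth and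
the embedding i detects smoothness (`dSmooth_of_i`).

For part (b), let f be any homomorphism of extensions X → Y, with F the induced morphism of
2-groupoids and q : Γ → Δ the induced functor. The square formed by F, q and the two projections
commutes strictly. Applying f̃ to the relation (AD_γ g) γ = γ g gives AD_{f̃γ} θ_{s(γ)} = θ_{t(γ)}
AD_γ, so θ is a natural 2-transformation between the two morphisms to [G → Aut(G)]
(`natEquiv_adHom`). Cancelling the Morita projections shows that q followed by the bundle of Y is
equivalent to the bundle of X (`fwd_quoHom_bundle`).

If f is Morita, then q is Morita and can be inverted, so the two bundles correspond with ν the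
identity; chains of Morita morphisms are handled by concatenation. In the localized form,
`fwd_quoHom_bundle` says that extensions map functorially to the category of generalized morphisms
over [G → Aut(G)]. This functor inverts Morita morphisms, so it factors through the localization and
carries isomorphisms there to isomorphisms over the 2-group. -/

namespace LieTwo

noncomputable section

/-! ### Manifolds and surjective submersions in terms of plots. -/

section Manifolds

variable {X Y Z : Type u} [DiffeologicalSpace X] [DiffeologicalSpace Y] [DiffeologicalSpace Z]

theorem dSmooth_subtype_val (P : X → Prop) : DSmooth (fun x : {x // P x} => (x : X)) :=
  fun _ _ hp => hp

theorem dSmooth_subtype_mk {P : X → Prop} {f : Y → X} (hf : DSmooth f) (h : ∀ y, P (f y)) :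
    DSmooth (fun y => (⟨f y, h y⟩ : {x // P x})) :=
  fun k p hp => hf k p hp

theorem isSmoothManifold_of_subsingleton [Subsingleton X] [Nonempty X] : IsSmoothManifold X := by
  classical
  let hd : TopologicalSpace PUnit.{u + 1} := inferInstance
  have hc : IsOpenEmbedding (fun _ : PUnit.{u + 1} => (0 : EuclideanSpace ℝ (Fin 0))) :=
    IsOpenEmbedding.of_continuous_injective_isOpenMap continuous_const
      (fun _ _ _ => rfl) fun _ _ => isOpen_discrete _
  obtain ⟨x⟩ := ‹Nonempty X›
  refine ⟨EuclideanSpace ℝ (Fin 0), inferInstance, inferInstance, inferInstance, PUnit.{u + 1},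
    hd, hc.singletonChartedSpace, hc.isManifold_singleton, inferInstance, inferInstance,
    ⟨fun _ => PUnit.unit, fun _ => x, fun _ => Subsingleton.elim _ _, fun _ => rfl⟩,
    fun k p => ⟨fun _ => ?_, fun _ => ?_⟩⟩
  · let _ := hc.singletonChartedSpace
    exact contMDiff_const
  · have : p = fun _ => x := funext fun _ => Subsingleton.elim _ _
    rw [this]
    exact isPlot_const

theorem IsSmoothManifold.prod (hX : IsSmoothManifold X) (hY : IsSmoothManifold Y) :
    IsSmoothManifold (X × Y) := by
  obtain ⟨E, _, _, _, N, _, _, _, _, _, e, he⟩ := hX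
  obtain ⟨E', _, _, _, N', _, _, _, _, _, e', he'⟩ := hY
  -- `ModelProd E E'` is `E × E'` by definition. Naming the charted space this way lets the product
  -- be modelled on a single vector space, as `IsSmoothManifold` demands.
  let hC : ChartedSpace (E × E') (N × N') := prodChartedSpace E N E' N'
  have hM : IsManifold 𝓘(ℝ, E × E') ∞ (N × N') := by
    rw [modelWithCornersSelf_prod]
    exact IsManifold.prod (I := 𝓘(ℝ, E)) (I' := 𝓘(ℝ, E')) N N'
  refine ⟨E × E', inferInstance, inferInstance, inferInstance, N × N', inferInstance,
    inferInstance, hM, inferInstance, inferInstance, e.prodCongr e', fun k p => ?_⟩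
  have h1 : IsPlot p ↔ IsPlot (fun v => (p v).1) ∧ IsPlot (fun v => (p v).2) := Iff.rfl
  rw [h1, he, he', modelWithCornersSelf_prod]
  exact (contMDiff_prod_iff (I' := 𝓘(ℝ, E)) (J' := 𝓘(ℝ, E')) (M' := N) (N' := N')
    (Prod.map e e' ∘ p)).symm

theorem IsSmoothManifold.of_isDiffeo {f : Y → X} (hf : IsDiffeo f) (hX : IsSmoothManifold X) :
    IsSmoothManifold Y := by
  obtain ⟨E, _, _, _, N, _, _, _, _, _, e, he⟩ := hX
  obtain ⟨hf, g, hg, hl, hr⟩ := hf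
  refine ⟨E, inferInstance, inferInstance, inferInstance, N, inferInstance, inferInstance,
    inferInstance, inferInstance, inferInstance,
    (⟨f, g, hl, hr⟩ : Y ≃ X).trans e, fun k p => ?_⟩
  have : ⇑((⟨f, g, hl, hr⟩ : Y ≃ X).trans e) ∘ p = e ∘ (f ∘ p) := rfl
  rw [this, ← he]
  refine ⟨fun h => hf k p h, fun h => ?_⟩
  have := hg k _ h
  rwa [← Function.comp_assoc, hl.comp_eq_id] at this

theorem IsDiffeo.isSurjSubmersion {f : X → Y} (hf : IsDiffeo f) : IsSurjSubmersion f := by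
  obtain ⟨hf, g, hg, hl, hr⟩ := hf
  exact ⟨hf, hr.surjective, fun k p hp v x hx =>
    ⟨g ∘ p, hg k p hp, by simp [← hx, hl x], .of_forall fun w => hr (p w)⟩⟩

theorem isDiffeo_id : IsDiffeo (id : X → X) :=
  ⟨dSmooth_id, id, dSmooth_id, fun _ => rfl, fun _ => rfl⟩

/-- A plot is lifted in two stages, through `g` at `f x` and then through `f` at `x`; both lifts are
valid on a common neighbourhood. -/
theorem IsSurjSubmersion.comp {f : X → Y} {g : Y → Z} (hg : IsSurjSubmersion g)
    (hf : IsSurjSubmersion f) : IsSurjSubmersion (fun x => g (f x)) := by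
  refine ⟨hg.1.comp hf.1, hg.2.1.comp hf.2.1, fun k p hp v x hx => ?_⟩
  obtain ⟨q, hq, hqv, hqw⟩ := hg.2.2 k p hp v (f x) hx
  obtain ⟨r, hr, hrv, hrw⟩ := hf.2.2 k q hq v x hqv.symm
  refine ⟨r, hr, hrv, ?_⟩
  filter_upwards [hqw, hrw] with w h1 h2
  rw [h2, h1]

theorem isSurjSubmersion_snd [Nonempty X] : IsSurjSubmersion (fun z : X × Y => z.2) :=
  ⟨dSmooth_snd, fun y => ⟨(Classical.arbitrary X, y), rfl⟩, fun _ p hp _ x hx =>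
    ⟨fun w => (x.1, p w), ⟨isPlot_const, hp⟩, Prod.ext rfl hx.symm, .of_forall fun _ => rfl⟩⟩

theorem isSurjSubmersion_of_subsingleton [Subsingleton Y] [Nonempty X] (f : X → Y) :
    IsSurjSubmersion f := by
  obtain ⟨x₀⟩ := ‹Nonempty X›
  refine ⟨?_, fun y => ⟨x₀, Subsingleton.elim _ _⟩, fun k p _ _ x _ =>
    ⟨fun _ => x, isPlot_const, rfl, .of_forall fun _ => Subsingleton.elim _ _⟩⟩
  have : f = fun _ => f x₀ := funext fun _ => Subsingleton.elim _ _
  rw [this]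
  exact dSmooth_const

end Manifolds

/-! ### Smooth maps into G and Aut(G). -/

section LieGroupSmooth

variable {G : Type u} [Group G] [DiffeologicalSpace G] {X : Type*} [DiffeologicalSpace X]

theorem IsLieGroup.isSmoothManifold [IsLieGroup G] : IsSmoothManifold G := by
  obtain ⟨n, _, _, _, _, _, h⟩ := IsLieGroup.exists_lieGroup (G := G)
  exact ⟨EuclideanSpace ℝ (Fin n), inferInstance, inferInstance, inferInstance, G, inferInstance,
    inferInstance, inferInstance, inferInstance, inferInstance, Equiv.refl G, h⟩

theorem dSmooth_group_mul [IsLieGroup G] {a b : X → G} (ha : DSmooth a) (hb : DSmooth b) :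
    DSmooth (fun x => a x * b x) := by
  obtain ⟨n, _, _, _, _, _, h⟩ := IsLieGroup.exists_lieGroup (G := G)
  intro k p hp
  have h1 := ha k p hp
  have h2 := hb k p hp
  rw [h] at h1 h2 ⊢
  exact h1.mul h2

theorem dSmooth_group_inv [IsLieGroup G] {a : X → G} (ha : DSmooth a) :
    DSmooth (fun x => (a x)⁻¹) := by
  obtain ⟨n, _, _, _, _, _, h⟩ := IsLieGroup.exists_lieGroup (G := G)
  intro k p hp
  have h1 := ha k p hp
  rw [h] at h1 ⊢
  exact h1.inv

theorem LieAut.dSmooth_inv {a : X → LieAut G} (ha : DSmooth a) : DSmooth (fun x => (a x)⁻¹) := by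
  intro k p hp
  have h1 := ha k p hp
  exact ⟨h1.2, by simpa only [Function.comp, inv_inv] using h1.1⟩

theorem LieAut.dSmooth_ev {a : X → LieAut G} {b : X → G} (ha : DSmooth a) (hb : DSmooth b) :
    DSmooth (fun x => (a x).ev (b x)) := fun k p hp =>
  (ha k p hp).1 k (fun v => (v, b (p v))) ⟨isPlot_id, hb k p hp⟩

/-- The plots of Aut(G) are defined by a condition on families over ℝᵏ; it follows for arbitrary
parameter spaces by restriction along plots. Smoothness of the inverse is a separate requirement. -/
theorem LieAut.dSmooth_of_ev {a : X → LieAut G} (h : DSmooth (fun x : X × G => (a x.1).ev x.2))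
    (h' : DSmooth (fun x : X × G => ((a x.1)⁻¹).ev x.2)) : DSmooth a := by
  intro k p hp
  have hq : DSmooth (fun x : EuclideanSpace ℝ (Fin k) × G => (p x.1, x.2)) :=
    dSmooth_prodMk (hp.dSmooth.comp dSmooth_fst) dSmooth_snd
  exact ⟨h.comp hq, h'.comp hq⟩

theorem AD_inv [IsLieGroup G] (g : G) : (AD g)⁻¹ = AD g⁻¹ :=
  inv_eq_of_mul_eq_one_left (LieAut.ext' fun x => by simp [mul_assoc])

theorem dSmooth_AD [IsLieGroup G] {a : X → G} (ha : DSmooth a) : DSmooth (fun x => AD (a x)) := by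
  have key : ∀ b : X → G, DSmooth b → DSmooth (fun x : X × G => (AD (b x.1)).ev x.2) :=
    fun b hb => dSmooth_group_mul (dSmooth_group_mul (hb.comp dSmooth_fst) dSmooth_snd)
      (dSmooth_group_inv (hb.comp dSmooth_fst))
  refine LieAut.dSmooth_of_ev (key a ha) ?_
  simp only [AD_inv]
  exact key _ (dSmooth_group_inv ha)

/-- This is the vertical target u of the 2-group. A lift through (g, a) keeps g constant and solves
AD_g a' = p for a', so it is even global. -/
theorem isSurjSubmersion_AD_mul [IsLieGroup G] :
    IsSurjSubmersion (fun x : G × LieAut G => AD x.1 * x.2) := by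
  refine ⟨LieAut.dSmooth_mul (dSmooth_AD dSmooth_fst) dSmooth_snd, fun a => ⟨(1, a), ?_⟩,
    fun k p hp v x hx => ⟨fun w => (x.1, AD x.1⁻¹ * p w), ?_, ?_, .of_forall fun w => ?_⟩⟩
  · exact LieAut.ext' fun g => by simp
  · exact ⟨isPlot_const, (LieAut.dSmooth_mul dSmooth_const hp.dSmooth).isPlot⟩
  · refine Prod.ext rfl ?_
    change AD x.1⁻¹ * p v = x.2
    rw [← hx]
    exact LieAut.ext' fun g => by simp [mul_assoc]
  · exact LieAut.ext' fun g => by simp [mul_assoc]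

end LieGroupSmooth

/-! ### Groupoids and [G → Aut(G)] as Lie 2-groupoids. -/

section LieTwoGroupoids

theorem GroupoidStr.isLie_trivial {A : Type u} [DiffeologicalSpace A] (hA : IsSmoothManifold A) :
    (GroupoidStr.trivial A).IsLie where
  objects := hA
  arrows := hA
  s := isDiffeo_id.isSurjSubmersion
  t := isDiffeo_id.isSurjSubmersion
  one := dSmooth_id
  mul := dSmooth_fst.comp (dSmooth_subtype_val _)
  inv := dSmooth_id

theorem GroupoidStr.IsLie.ofGroupoid {M A : Type u} [DiffeologicalSpace M] [DiffeologicalSpace A]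
    {Γ : GroupoidStr M A} (h : Γ.IsLie) : (TwoGroupoid.ofGroupoid Γ).IsLie :=
  ⟨h, isLie_trivial h.arrows, h⟩

variable {G : Type u} [Group G] [DiffeologicalSpace G] [IsLieGroup G]

/-- With a single object, the sources and targets of `base` and `horiz` are trivially submersions.
The only nontrivial one is the vertical target, treated in `isSurjSubmersion_AD_mul`; `hAut`
supplies the manifold structure. -/
theorem isLie_autTwoGroup (hAut : IsSmoothManifold (LieAut G)) : (autTwoGroup G).IsLie where
  base :=
    { objects := isSmoothManifold_of_subsingleton (X := PUnit.{u + 1})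
      arrows := hAut
      s := isSurjSubmersion_of_subsingleton (X := LieAut G) (Y := PUnit.{u + 1}) _
      t := isSurjSubmersion_of_subsingleton (X := LieAut G) (Y := PUnit.{u + 1}) _
      one := dSmooth_const
      mul := LieAut.dSmooth_mul (dSmooth_fst.comp (dSmooth_subtype_val _))
        (dSmooth_snd.comp (dSmooth_subtype_val _))
      inv := LieAut.dSmooth_inv dSmooth_id }
  vert :=
    { objects := hAut
      arrows := IsLieGroup.isSmoothManifold.prod hAut
      s := isSurjSubmersion_snd
      t := isSurjSubmersion_AD_mul
      one := dSmooth_prodMk dSmooth_const dSmooth_id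
      mul := by
        have h1 := (dSmooth_fst (X := G × LieAut G) (Y := G × LieAut G)).comp
          (dSmooth_subtype_val fun p => (autTwoGroup G).vert.s p.1 = (autTwoGroup G).vert.t p.2)
        have h2 := (dSmooth_snd (X := G × LieAut G) (Y := G × LieAut G)).comp
          (dSmooth_subtype_val fun p => (autTwoGroup G).vert.s p.1 = (autTwoGroup G).vert.t p.2)
        exact dSmooth_prodMk (dSmooth_group_mul (dSmooth_fst.comp h1) (dSmooth_fst.comp h2))
          (dSmooth_snd.comp h2)
      inv := dSmooth_prodMk (dSmooth_group_inv dSmooth_fst)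
        (LieAut.dSmooth_mul (dSmooth_AD dSmooth_fst) dSmooth_snd) }
  horiz :=
    { objects := isSmoothManifold_of_subsingleton (X := PUnit.{u + 1})
      arrows := IsLieGroup.isSmoothManifold.prod hAut
      s := isSurjSubmersion_of_subsingleton (X := G × LieAut G) (Y := PUnit.{u + 1}) _
      t := isSurjSubmersion_of_subsingleton (X := G × LieAut G) (Y := PUnit.{u + 1}) _
      one := dSmooth_const
      mul := by
        have h1 := (dSmooth_fst (X := G × LieAut G) (Y := G × LieAut G)).comp
          (dSmooth_subtype_val fun p => (autTwoGroup G).horiz.s p.1 = (autTwoGroup G).horiz.t p.2)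
        have h2 := (dSmooth_snd (X := G × LieAut G) (Y := G × LieAut G)).comp
          (dSmooth_subtype_val fun p => (autTwoGroup G).horiz.s p.1 = (autTwoGroup G).horiz.t p.2)
        exact dSmooth_prodMk (dSmooth_group_mul (dSmooth_fst.comp h1)
          (LieAut.dSmooth_ev (dSmooth_snd.comp h1) (dSmooth_fst.comp h2)))
          (LieAut.dSmooth_mul (dSmooth_snd.comp h1) (dSmooth_snd.comp h2))
      inv := dSmooth_prodMk (LieAut.dSmooth_ev (LieAut.dSmooth_inv dSmooth_snd)
          (dSmooth_group_inv dSmooth_fst)) (LieAut.dSmooth_inv dSmooth_snd) }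

end LieTwoGroupoids

/-! ### Morita morphisms of groupoids as Morita morphisms of 2-groupoids. -/

open TwoGroupoid

theorem GroupoidStr.IsLie.dSmooth_mul {O A Z : Type u} [DiffeologicalSpace O]
    [DiffeologicalSpace A] [DiffeologicalSpace Z] {Γ : GroupoidStr O A} (hΓ : Γ.IsLie)
    {a b : Z → A} (ha : DSmooth a) (hb : DSmooth b) (h : ∀ z, Γ.s (a z) = Γ.t (b z)) :
    DSmooth (fun z => Γ.mul (a z) (b z) (h z)) :=
  hΓ.mul.comp (dSmooth_subtype_mk (dSmooth_prodMk ha hb) h)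

theorem GroupoidStr.IsHom.dSmooth_toPullback {O A O' A' : Type u} [DiffeologicalSpace O]
    [DiffeologicalSpace A] [DiffeologicalSpace O'] [DiffeologicalSpace A'] {Γ : GroupoidStr O A}
    {Δ : GroupoidStr O' A'} {f₀ : O → O'} {f₁ : A → A'} (h : Γ.IsHom Δ f₀ f₁) (hΓ : Γ.IsLie)
    (hf : DSmooth f₁) : DSmooth h.toPullback :=
  dSmooth_subtype_mk (dSmooth_prodMk hΓ.s.1 (dSmooth_prodMk hf hΓ.t.1)) _

theorem TwoGroupoid.Hom.isHom_toPullback {Γ Δ : TwoGroupoid.{u}} (f : Hom Γ Δ) :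
    Γ.vert.IsHom (Δ.vertPullback f.f₀) f.base.toPullback f.horiz.toPullback where
  s x := Subtype.ext (Prod.ext (Γ.s_s x).symm (Prod.ext (f.vert.s x) (Γ.t_s x).symm))
  t x := Subtype.ext (Prod.ext (Γ.s_t x).symm (Prod.ext (f.vert.t x) (Γ.t_t x).symm))
  one a := Subtype.ext (Prod.ext (Γ.s_vone a) (Prod.ext (f.vert.one a) (Γ.t_vone a)))
  mul x y h := Subtype.ext (Prod.ext
    -- The composite in the pullback records the source object of `x`, whereas `s_vmul` gives that
    -- of `y`. They agree because vertically composable 2-arrows share a 1-arrow.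
    ((Γ.s_vmul x y h).trans (by
      change Γ.horiz.s y = Γ.horiz.s x
      rw [← Γ.s_t, ← h, Γ.s_s]))
    (Prod.ext (f.vert.mul x y h) (Γ.t_vmul x y h)))

/-- A functor, seen as a morphism of 2-groupoids. -/
def TwoGroupoid.ofGroupoidHom {M A M' A' : Type u} [DiffeologicalSpace M] [DiffeologicalSpace A]
    [DiffeologicalSpace M'] [DiffeologicalSpace A'] {Γ : GroupoidStr M A} {Δ : GroupoidStr M' A'}
    {f₀ : M → M'} {f₁ : A → A'} (h : Γ.IsHom Δ f₀ f₁) : Hom (ofGroupoid Γ) (ofGroupoid Δ) where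
  f₀ := f₀
  f₁ := f₁
  f₂ := f₁
  base := h
  vert := ⟨fun _ => rfl, fun _ => rfl, fun _ => rfl, fun _ _ _ => rfl⟩
  horiz := h

/-- The conditions on objects and 1-arrows are those of a Morita morphism of groupoids. On 2-arrows,
the pullback consists of pairs (a, b) with the same image in Δ₁[Γ₀]; since Γ₁ → Δ₁[Γ₀] is injective,
only the identities a = b occur. -/
theorem GroupoidStr.IsMorita.ofGroupoidHom {M A M' A' : Type u} [DiffeologicalSpace M]
    [DiffeologicalSpace A] [DiffeologicalSpace M'] [DiffeologicalSpace A'] {Γ : GroupoidStr M A}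
    {Δ : GroupoidStr M' A'} {f₀ : M → M'} {f₁ : A → A'} (h : Γ.IsMorita Δ f₀ f₁) :
    (TwoGroupoid.ofGroupoidHom h.isHom).IsMorita where
  smooth := ⟨h.submersion.1, h.smooth, h.smooth⟩
  objects := h.submersion
  arrows := h.cartesian.isSurjSubmersion
  twoArrows :=
    { isHom := Hom.isHom_toPullback _
      smooth := h.cartesian.1
      submersion := h.cartesian.isSurjSubmersion
      cartesian := by
        refine ⟨dSmooth_subtype_mk
          (dSmooth_prodMk dSmooth_id (dSmooth_prodMk h.cartesian.1 dSmooth_id)) _,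
          fun x => x.1.1, dSmooth_fst.comp (dSmooth_subtype_val _), fun _ => rfl, ?_⟩
        obtain ⟨-, g, -, hg, -⟩ := h.cartesian
        rintro ⟨⟨a, y, b⟩, h1, h2⟩
        change y = h.isHom.toPullback a at h1
        change y = h.isHom.toPullback b at h2
        have hab : a = b := hg.injective (h1.symm.trans h2)
        exact Subtype.ext (Prod.ext rfl (Prod.ext h1.symm hab)) }

/-! ### Part (a): the 2-groupoid and the bundle of an extension. -/

namespace LieExt

variable {G : Type u} [Group G] [DiffeologicalSpace G] (X : LieExt G)
  {Z : Type u} [DiffeologicalSpace Z]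

theorem dSmooth_i {m : Z → X.M} {g : Z → G} (hm : DSmooth m) (hg : DSmooth g) :
    DSmooth (fun z => X.i (m z) (g z)) := fun k p hp =>
  (X.i_embed.2 k (fun v => (m (p v), g (p v)))).1 ⟨hm k p hp, hg k p hp⟩

/-- Since `diff` and `adFun` are obtained by choice, their smoothness cannot be read off a formula.
It is checked after applying the embedding i, where they become products in Γ̃. -/
theorem dSmooth_of_i {m : Z → X.M} {g : Z → G} (h : DSmooth (fun z => X.i (m z) (g z))) :
    DSmooth g := fun k p hp =>
  ((X.i_embed.2 k (fun v => (m (p v), g (p v)))).2 (h k p hp)).2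

theorem dSmooth_diff {a b : Z → X.Tot} (ha : DSmooth a) (hb : DSmooth b)
    (h : ∀ z, X.φ (a z) = X.φ (b z)) : DSmooth (fun z => X.diff (a z) (b z) (h z)) := by
  refine X.dSmooth_of_i (m := fun z => X.tot.t (a z)) ?_
  simp only [X.i_diff]
  exact X.tot_lie.dSmooth_mul ha (X.tot_lie.inv.comp hb) _

theorem dSmooth_adFun_comp {a : Z → X.Tot} {g : Z → G} (ha : DSmooth a) (hg : DSmooth g) :
    DSmooth (fun z => X.adFun (a z) (g z)) := by
  refine X.dSmooth_of_i (m := fun z => X.tot.t (a z)) ?_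
  simp only [X.i_adFun]
  exact X.tot_lie.dSmooth_mul (X.tot_lie.dSmooth_mul ha
    (X.dSmooth_i (X.tot_lie.s.1.comp ha) hg) _) (X.tot_lie.inv.comp ha) _

/-- The inverse of AD_γ is by construction AD of γ⁻¹, so one smoothness statement for evaluation
serves both conditions. -/
theorem dSmooth_ad : DSmooth X.ad :=
  LieAut.dSmooth_of_ev (X.dSmooth_adFun_comp dSmooth_fst dSmooth_snd)
    (X.dSmooth_adFun_comp (X.tot_lie.inv.comp dSmooth_fst) dSmooth_snd)

/-- `g_{t(γ)} · γ`. -/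
def leftMul (g : G) (γ : X.Tot) : X.Tot :=
  X.tot.mul (X.i (X.tot.t γ) g) γ (X.s_i _ _)

theorem φ_leftMul (g : G) (γ : X.Tot) : X.φ (X.leftMul g γ) = X.φ γ := by
  rw [leftMul, X.φ_hom.mul]
  refine (X.quo.mul_congr ?_ rfl _).trans (X.quo.one_mul (X.φ γ))
  rw [X.φ_i, X.t_φ]

theorem diff_leftMul (g : G) (γ : X.Tot) :
    X.diff (X.leftMul g γ) γ (X.φ_leftMul g γ) = g := by
  refine (X.diff_unique _ _ _ _ ((X.s_i _ _).trans (X.t_eq_of_φ (X.φ_leftMul g γ))) ?_).symm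
  exact X.tot.mul_congr (by rw [X.t_eq_of_φ (X.φ_leftMul g γ)]) rfl _

theorem leftMul_diff (a b : X.Tot) (h : X.φ a = X.φ b) : X.leftMul (X.diff a b h) b = a := by
  refine Eq.trans ?_ (X.diff_mul a b h ((X.s_i _ _).trans (X.t_eq_of_φ h)))
  exact X.tot.mul_congr (by rw [X.t_eq_of_φ h]) rfl _

/-- The diffeomorphism `Γ̃ ×_Γ Γ̃ → G × Γ̃`, `(γ₁, γ₂) ↦ (γ₁ γ₂⁻¹, γ₂)`. -/
theorem isDiffeo_diff :
    IsDiffeo (fun x : X.twoGroupoid.T => (X.diff x.1.1 x.1.2 x.2, x.1.2)) := by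
  have h1 : DSmooth (fun x : X.twoGroupoid.T => x.1.1) := dSmooth_fst.comp (dSmooth_subtype_val _)
  have h2 : DSmooth (fun x : X.twoGroupoid.T => x.1.2) := dSmooth_snd.comp (dSmooth_subtype_val _)
  refine ⟨dSmooth_prodMk (X.dSmooth_diff h1 h2 fun x => x.2) h2,
    fun x => ⟨(X.leftMul x.1 x.2, x.2), X.φ_leftMul _ _⟩, ?_, fun x => ?_, fun x => ?_⟩
  · exact dSmooth_subtype_mk (dSmooth_prodMk (X.tot_lie.dSmooth_mul
      (X.dSmooth_i (X.tot_lie.t.1.comp dSmooth_snd) dSmooth_fst) dSmooth_snd _) dSmooth_snd) _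
  · exact Subtype.ext (Prod.ext (X.leftMul_diff _ _ x.2) rfl)
  · exact Prod.ext (X.diff_leftMul _ _) rfl

/-- Under `isDiffeo_diff`, l becomes the projection G × Γ̃ → Γ̃. The target u is l composed with the
swap of the two factors, and the horizontal source and target are those of Γ̃ composed with l. -/
theorem isLie_twoGroupoid [IsLieGroup G] : X.twoGroupoid.IsLie := by
  have h1 : DSmooth (fun x : X.twoGroupoid.T => x.1.1) := dSmooth_fst.comp (dSmooth_subtype_val _)
  have h2 : DSmooth (fun x : X.twoGroupoid.T => x.1.2) := dSmooth_snd.comp (dSmooth_subtype_val _)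
  have hT : IsSmoothManifold X.twoGroupoid.T :=
    (IsLieGroup.isSmoothManifold.prod X.tot_lie.arrows).of_isDiffeo X.isDiffeo_diff
  have hs : IsSurjSubmersion (fun x : X.twoGroupoid.T => x.1.2) :=
    (isSurjSubmersion_snd (X := G)).comp X.isDiffeo_diff.isSurjSubmersion
  have hi : IsDiffeo X.twoGroupoid.vert.inv := by
    have : DSmooth X.twoGroupoid.vert.inv := dSmooth_subtype_mk (dSmooth_prodMk h2 h1) _
    exact ⟨this, _, this, fun _ => rfl, fun _ => rfl⟩
  have hp : ∀ P : X.twoGroupoid.T × X.twoGroupoid.T → Prop,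
      DSmooth (fun p : {p // P p} => p.1.1) ∧ DSmooth (fun p : {p // P p} => p.1.2) := fun P =>
    ⟨dSmooth_fst.comp (dSmooth_subtype_val _), dSmooth_snd.comp (dSmooth_subtype_val _)⟩
  refine ⟨X.tot_lie, ?_, ?_⟩
  · exact
    { objects := X.tot_lie.arrows
      arrows := hT
      s := hs
      t := hs.comp hi.isSurjSubmersion
      one := dSmooth_subtype_mk (dSmooth_prodMk (dSmooth_id (X := X.Tot))
        (dSmooth_id (X := X.Tot))) _
      mul := dSmooth_subtype_mk (dSmooth_prodMk (h1.comp (hp _).1) (h2.comp (hp _).2)) _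
      inv := hi.1 }
  · exact
    { objects := X.tot_lie.objects
      arrows := hT
      s := X.tot_lie.s.comp hs
      t := X.tot_lie.t.comp hs
      one := dSmooth_subtype_mk (dSmooth_prodMk X.tot_lie.one X.tot_lie.one) _
      mul := dSmooth_subtype_mk (dSmooth_prodMk
        (X.tot_lie.dSmooth_mul (h1.comp (hp _).1) (h1.comp (hp _).2) _)
        (X.tot_lie.dSmooth_mul (h2.comp (hp _).1) (h2.comp (hp _).2) _)) _
      inv := dSmooth_subtype_mk (dSmooth_prodMk (X.tot_lie.inv.comp h1)
        (X.tot_lie.inv.comp h2)) _ }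

theorem isSmooth_adHom [IsLieGroup G] : X.adHom.IsSmooth := by
  have h1 : DSmooth (fun x : X.twoGroupoid.T => x.1.1) := dSmooth_fst.comp (dSmooth_subtype_val _)
  have h2 : DSmooth (fun x : X.twoGroupoid.T => x.1.2) := dSmooth_snd.comp (dSmooth_subtype_val _)
  exact ⟨dSmooth_const, X.dSmooth_ad,
    dSmooth_prodMk (X.dSmooth_diff h1 h2 fun x => x.2) (X.dSmooth_ad.comp h2)⟩

theorem isSmooth_proj : X.proj.IsSmooth :=
  ⟨dSmooth_id, X.φ_submersion.1,
    X.φ_submersion.1.comp (dSmooth_snd.comp (dSmooth_subtype_val _))⟩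

theorem isMorita_proj [IsLieGroup G] : X.proj.IsMorita := by
  have hX := X.isLie_twoGroupoid
  have hp : IsSurjSubmersion X.proj.base.toPullback := by
    refine ⟨X.proj.base.dSmooth_toPullback hX.base X.isSmooth_proj.f₁, ?_, ?_⟩
    · rintro ⟨⟨m, a, n⟩, h1, h2⟩
      obtain ⟨γ, rfl⟩ := X.φ_submersion.2.1 a
      exact ⟨γ, Subtype.ext (Prod.ext ((X.s_φ γ).symm.trans h1)
        (Prod.ext rfl ((X.t_φ γ).symm.trans h2)))⟩
    · intro k p hp v γ hγ
      -- The map on objects is the identity, so a point of the pullback is determined by its arrow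
      -- in Γ. Lifting that component through φ suffices; the end components follow because φ
      -- preserves source and target.
      obtain ⟨q, hq, hqv, hqw⟩ := X.φ_submersion.2.2 k (fun w => (p w).1.2.1) hp.2.1 v γ
        (congrArg (fun z => z.1.2.1) hγ)
      refine ⟨q, hq, hqv, ?_⟩
      filter_upwards [hqw] with w hw
      have h1 : X.quo.s (p w).1.2.1 = (p w).1.1 := (p w).2.1
      have h2 : X.quo.t (p w).1.2.1 = (p w).1.2.2 := (p w).2.2
      refine Subtype.ext (Prod.ext ?_ (Prod.ext hw ?_))
      · rw [← h1, ← hw, X.s_φ]; rfl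
      · rw [← h2, ← hw, X.t_φ]; rfl
  have hs := X.proj.horiz.dSmooth_toPullback hX.horiz X.isSmooth_proj.f₂
  refine ⟨X.isSmooth_proj, isDiffeo_id.isSurjSubmersion, hp, Hom.isHom_toPullback _, hs, hp, ?_⟩
  -- The target has only identity 2-arrows, so the two ends of `y` have the same image in Γ.
  have hφ : ∀ y : ((ofGroupoid X.quo).vertPullback X.proj.f₀).Pullback X.proj.base.toPullback,
      X.φ y.1.2.2 = X.φ y.1.1 := fun y =>
    congrArg (fun z : (ofGroupoid X.quo).base.Pullback X.proj.f₀ => z.1.2.1)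
      (y.2.2.symm.trans y.2.1)
  refine ⟨dSmooth_subtype_mk (dSmooth_prodMk hX.vert.s.1 (dSmooth_prodMk hs hX.vert.t.1)) _,
    -- The order is reversed: the pullback lists the vertical source first, while l(γ₁, γ₂) = γ₂ and
    -- u(γ₁, γ₂) = γ₁.
    fun y => ⟨(y.1.2.2, y.1.1), hφ y⟩, ?_, fun _ => rfl, fun y => ?_⟩
  · exact dSmooth_subtype_mk (dSmooth_prodMk
      (dSmooth_snd.comp (dSmooth_snd.comp (dSmooth_subtype_val _)))
      (dSmooth_fst.comp (dSmooth_subtype_val _))) _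
  · exact Subtype.ext (Prod.ext rfl (Prod.ext y.2.1.symm rfl))

theorem isGenMor_bundle [IsLieGroup G] (hAut : IsSmoothManifold (LieAut G)) :
    X.bundle.IsGenMor :=
  ⟨X.quo_lie.ofGroupoid, X.isMorita_proj, X.isLie_twoGroupoid, X.isSmooth_adHom,
    isLie_autTwoGroup hAut⟩

end LieExt

/-! ### Morphisms of 2-groupoids induced by homomorphisms of extensions. -/

section HomLemmas

variable {G : Type u} [Group G] [DiffeologicalSpace G]

namespace LieExt

variable {X Y : LieExt G} (f : X ⟶ Y)

/-- The morphism of 2-groupoids induced by a homomorphism of extensions. -/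
def twoHom : TwoGroupoid.Hom X.twoGroupoid Y.twoGroupoid where
  f₀ := f.f₀
  f₁ := f.fTot
  f₂ := fun x => ⟨(f.fTot x.1.1, f.fTot x.1.2), by rw [f.comm, f.comm, x.2]⟩
  base := f.homTot
  vert := ⟨fun _ => rfl, fun _ => rfl, fun _ => rfl, fun _ _ _ => rfl⟩
  horiz := ⟨fun _ => f.homTot.s _, fun _ => f.homTot.t _,
    fun _ => Subtype.ext (Prod.ext (f.homTot.one _) (f.homTot.one _)),
    fun _ _ _ => Subtype.ext (Prod.ext (f.homTot.mul _ _ _) (f.homTot.mul _ _ _))⟩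

/-- The functor `Γ → Δ` induced by a homomorphism of extensions, as a morphism of 2-groupoids. -/
def quoHom : TwoGroupoid.Hom (ofGroupoid X.quo) (ofGroupoid Y.quo) := ofGroupoidHom f.homQuo

theorem isSmooth_twoHom : (twoHom f).IsSmooth :=
  ⟨f.smooth₀, f.smoothTot, dSmooth_subtype_mk (dSmooth_prodMk
    (f.smoothTot.comp (dSmooth_fst.comp (dSmooth_subtype_val _)))
    (f.smoothTot.comp (dSmooth_snd.comp (dSmooth_subtype_val _)))) _⟩

theorem isSmooth_quoHom : (quoHom f).IsSmooth := ⟨f.smooth₀, f.smoothQuo, f.smoothQuo⟩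

theorem isMorita_quoHom (hf : morita G f) : (quoHom f).IsMorita := hf.2.1.ofGroupoidHom

theorem twoHom_comp_proj : (twoHom f).comp Y.proj = X.proj.comp (quoHom f) := by
  have h1 : Y.φ ∘ f.fTot = f.fQuo ∘ X.φ := funext f.comm
  have h2 : Y.proj.f₂ ∘ (twoHom f).f₂ = f.fQuo ∘ X.proj.f₂ := funext fun x => f.comm x.1.2
  unfold TwoGroupoid.Hom.comp
  congr 1

/-- Apply f̃ to the equation (AD_γ g) γ = γ g that characterizes AD_γ g, rewrite the two kernel
elements with θ, and use uniqueness in `Y`. -/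
theorem adFun_fTot {θ : X.M → LieAut G}
    (hθ : ∀ m g, f.fTot (X.i m g) = Y.i (f.f₀ m) ((θ m).ev g))
    (γ : X.Tot) (g : G) :
    Y.adFun (f.fTot γ) ((θ (X.tot.s γ)).ev g) = (θ (X.tot.t γ)).ev (X.adFun γ g) := by
  refine (Y.adFun_unique _ _ _ (Y.s_i _ _) ?_).symm
  have h := congrArg f.fTot (X.adFun_mul γ g (X.s_i _ _))
  rw [f.homTot.mul, f.homTot.mul] at h
  refine Eq.trans (Y.tot.mul_congr ?_ rfl _) (h.trans (Y.tot.mul_congr rfl ?_ _))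
  · rw [hθ, f.homTot.t]
  · rw [hθ, f.homTot.s]

theorem ad_fTot {θ : X.M → LieAut G}
    (hθ : ∀ m g, f.fTot (X.i m g) = Y.i (f.f₀ m) ((θ m).ev g))
    (γ : X.Tot) :
    Y.ad (f.fTot γ) * θ (X.tot.s γ) = θ (X.tot.t γ) * X.ad γ :=
  LieAut.ext' fun g => adFun_fTot f hθ γ g

/-- The same argument as for `adFun_fTot`, applied to the characterization (ab⁻¹) b = a. -/
theorem diff_fTot {θ : X.M → LieAut G}
    (hθ : ∀ m g, f.fTot (X.i m g) = Y.i (f.f₀ m) ((θ m).ev g))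
    (a b : X.Tot) (h : X.φ a = X.φ b) (h' : Y.φ (f.fTot a) = Y.φ (f.fTot b)) :
    Y.diff (f.fTot a) (f.fTot b) h' = (θ (X.tot.t a)).ev (X.diff a b h) := by
  refine (Y.diff_unique _ _ _ _ ((Y.s_i _ _).trans (Y.t_eq_of_φ h')) ?_).symm
  have e := congrArg f.fTot (X.diff_mul a b h ((X.s_i _ _).trans (X.t_eq_of_φ h)))
  rw [f.homTot.mul] at e
  refine Eq.trans (Y.tot.mul_congr ?_ rfl _) e
  rw [hθ, f.homTot.t]

/-- The family θ itself is the transformation. By `ad_fTot` its naturality squares commute on the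
nose, so the 2-cells can be taken to be identities; naturality for 2-arrows is then `diff_fTot`. -/
theorem natEquiv_adHom [IsLieGroup G] : X.adHom.NatEquiv ((twoHom f).comp Y.adHom) := by
  obtain ⟨θ, hθs, hθ⟩ := f.kernel
  -- The identity 2-arrow of θ_{t(a)} AD_a. Its source has the required form by definition; that its
  -- target is AD_{f̃a} θ_{s(a)} is `ad_fTot`.
  refine ⟨θ, fun a => (1, θ (X.tot.t a) * X.ad a), hθs, ?_, fun _ => ⟨rfl, rfl⟩,
    fun a => ⟨⟨rfl, rfl⟩, ⟨rfl, ?_⟩⟩, fun x _ _ _ _ => ?_, fun j i h _ _ _ => ?_⟩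
  · exact dSmooth_prodMk dSmooth_const
      (LieAut.dSmooth_mul (hθs.comp X.tot_lie.t.1) X.dSmooth_ad)
  · refine Eq.trans ?_ (ad_fTot f hθ a).symm
    exact LieAut.ext' fun g => by simp [autTwoGroup]
  · obtain ⟨⟨a, b⟩, hab⟩ := x
    have h1 := diff_fTot f hθ a b hab (by rw [f.comm, f.comm]; exact congrArg f.fQuo hab)
    have ht : X.tot.t a = X.tot.t b := X.t_eq_of_φ hab
    refine Prod.ext ?_ ?_
    -- The G-components of the two vertical composites. The horizontal target is read off `b`,
    -- whereas `h1` evaluates θ at the target of `a`.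
    · change Y.diff (f.fTot a) (f.fTot b) _ * (Y.ad (f.fTot b)).ev 1 * 1 =
        1 * (1 * (θ (X.tot.t b)).ev (X.diff a b hab))
      rw [h1, ht]
      simp
    · rfl
  · refine Prod.ext ?_ ?_
    · change (1 : G) = (1 * (Y.ad (f.fTot j)).ev 1) *
        (1 * (θ (X.tot.t j) * X.ad j).ev 1)
      simp
    · change θ (X.tot.t (X.tot.mul j i h)) * X.ad (X.tot.mul j i h) =
        θ (X.tot.t j) * X.ad j * X.ad i
      have ht : X.tot.t (X.tot.mul j i h) = X.tot.t j := X.tot.t_mul j i h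
      have ha : X.ad (X.tot.mul j i h) = X.ad j * X.ad i := X.ad_mul j i h
      exact (congrArg₂ (θ · * ·) ht ha).trans (mul_assoc _ _ _).symm

end LieExt

end HomLemmas

/-! ### Calculus of zigzags. -/

namespace Zigzag

variable {Γ Δ Λ Ξ : TwoGroupoid.{u}}

theorem append_nil (z : Zigzag Γ Δ) : z.append (nil Δ) = z := by
  induction z with
  | nil => rfl
  | fwd f z ih => exact congrArg (fwd f) ih
  | bwd f z ih => exact congrArg (bwd f) ih

theorem append_assoc (z : Zigzag Γ Δ) (w : Zigzag Δ Λ) (v : Zigzag Λ Ξ) :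
    (z.append w).append v = z.append (w.append v) := by
  induction z with
  | nil => rfl
  | fwd f z ih => exact congrArg (fwd f) (ih w)
  | bwd f z ih => exact congrArg (bwd f) (ih w)

theorem IsGenMor.append {z : Zigzag Γ Δ} {w : Zigzag Δ Λ} (hz : z.IsGenMor) (hw : w.IsGenMor) :
    (z.append w).IsGenMor := by
  induction z with
  | nil => exact hw
  | fwd f z ih => exact ⟨hz.1, hz.2.1, ih hz.2.2 hw⟩
  | bwd f z ih => exact ⟨hz.1, hz.2.1, ih hz.2.2 hw⟩

theorem IsMoritaEquiv.append {z : Zigzag Γ Δ} {w : Zigzag Δ Λ} (hz : z.IsMoritaEquiv)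
    (hw : w.IsMoritaEquiv) : (z.append w).IsMoritaEquiv := by
  induction z with
  | nil => exact hw
  | fwd f z ih => exact ⟨hz.1, hz.2.1, ih hz.2.2 hw⟩
  | bwd f z ih => exact ⟨hz.1, hz.2.1, ih hz.2.2 hw⟩

theorem IsMoritaEquiv.isGenMor {z : Zigzag Γ Δ} (hz : z.IsMoritaEquiv) : z.IsGenMor := by
  induction z with
  | nil => exact hz
  | fwd f z ih => exact ⟨hz.1, hz.2.1.smooth, ih hz.2.2⟩
  | bwd f z ih => exact ⟨hz.1, hz.2.1, ih hz.2.2⟩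

theorem IsGenMor.left {z : Zigzag Γ Δ} (hz : z.IsGenMor) : Γ.IsLie := by
  cases z with
  | nil => exact hz
  | fwd f z => exact hz.1
  | bwd f z => exact hz.1

theorem Equiv.fwd {f : Hom Γ Δ} (hΓ : Γ.IsLie) (hΔ : Δ.IsLie) (hf : f.IsSmooth)
    {z z' : Zigzag Δ Λ} (h : z.Equiv z') : (Zigzag.fwd f z).Equiv (Zigzag.fwd f z') :=
  precomp (w := .fwd f (.nil Δ)) ⟨hΓ, hf, hΔ⟩ h

theorem Equiv.bwd {f : Hom Δ Γ} (hΓ : Γ.IsLie) (hΔ : Δ.IsLie) (hf : f.IsMorita)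
    {z z' : Zigzag Δ Λ} (h : z.Equiv z') : (Zigzag.bwd f z).Equiv (Zigzag.bwd f z') :=
  precomp (w := .bwd f (.nil Δ)) ⟨hΓ, hf, hΔ⟩ h

/-- The generating relations concern short zigzags. Postcomposition lets them be applied at the head
of a longer one; here and in the next two lemmas the concatenations unfold by definition. -/
theorem equiv_fwd_comp {f : Hom Γ Δ} {g : Hom Δ Λ} (hΓ : Γ.IsLie) (hΔ : Δ.IsLie)
    (hf : f.IsSmooth) (hg : g.IsSmooth) {z : Zigzag Λ Ξ} (hz : z.IsGenMor) :
    (fwd f (fwd g z)).Equiv (fwd (f.comp g) z) :=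
  Equiv.postcomp hz (Equiv.comp hΓ hΔ hz.left hf hg)

theorem equiv_bwd_fwd {f : Hom Γ Δ} (hΓ : Γ.IsLie) (hf : f.IsMorita) {z : Zigzag Δ Λ}
    (hz : z.IsGenMor) : (bwd f (fwd f z)).Equiv z :=
  Equiv.postcomp hz (Equiv.bwd_fwd hΓ hz.left hf)

theorem equiv_fwd_bwd {f : Hom Γ Δ} (hΔ : Δ.IsLie) (hf : f.IsMorita) {z : Zigzag Γ Λ}
    (hz : z.IsGenMor) : (fwd f (bwd f z)).Equiv z :=
  Equiv.postcomp hz (Equiv.fwd_bwd hz.left hΔ hf)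

end Zigzag

open Zigzag

/-! ### Part (b): transport of bundles along homomorphisms and Morita equivalences. -/

namespace LieExt

variable {G : Type u} [Group G] [DiffeologicalSpace G] [IsLieGroup G]

/-- The bundle of an extension is the pullback of the bundle of any other extension to which it
maps. -/
theorem fwd_quoHom_bundle (hAut : IsSmoothManifold (LieAut G)) {X Y : LieExt G} (f : X ⟶ Y) :
    (fwd (quoHom f) Y.bundle).Equiv X.bundle := by
  have hK := isLie_autTwoGroup hAut
  have hX := X.isLie_twoGroupoid
  have hY := Y.isLie_twoGroupoid
  have hXq := X.quo_lie.ofGroupoid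
  have hYq := Y.quo_lie.ofGroupoid
  have hF := isSmooth_twoHom f
  have hq := isSmooth_quoHom f
  have hbY := Y.isGenMor_bundle hAut
  have haY : (fwd Y.adHom (nil _)).IsGenMor := ⟨hY, Y.isSmooth_adHom, hK⟩
  have hFa : ((twoHom f).comp Y.adHom).IsSmooth :=
    ⟨Y.isSmooth_adHom.f₀.comp hF.f₀, Y.isSmooth_adHom.f₁.comp hF.f₁,
      Y.isSmooth_adHom.f₂.comp hF.f₂⟩
  -- The comparison is made after precomposition with `X.proj`, where the strictly commuting square
  -- can be used.
  have e1 : (fwd X.proj (fwd (quoHom f) Y.bundle)).Equiv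
      (fwd (twoHom f) (fwd Y.proj Y.bundle)) := by
    refine (equiv_fwd_comp hX hXq X.isSmooth_proj hq hbY).trans ?_
    rw [← twoHom_comp_proj]
    exact (equiv_fwd_comp hX hY hF Y.isSmooth_proj hbY).symm
  -- `Y.bundle` starts with `Y.proj` reversed, which cancels against the forward `Y.proj`.
  have e2 : (fwd (twoHom f) (fwd Y.proj Y.bundle)).Equiv (fwd (twoHom f) (fwd Y.adHom (nil _))) :=
    .fwd hX hY hF (equiv_fwd_bwd hYq Y.isMorita_proj haY)
  have e3 : (fwd (twoHom f) (fwd Y.adHom (nil _))).Equiv (fwd X.adHom (nil _)) :=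
    (Equiv.comp hX hY hK hF Y.isSmooth_adHom).trans
      (Equiv.natEquiv hX hK X.isSmooth_adHom hFa (natEquiv_adHom f)).symm
  have hqY : (fwd (quoHom f) Y.bundle).IsGenMor := ⟨hXq, hq, hbY⟩
  -- `X.proj` is Morita, so it may be inserted backwards and forwards; after `e1`, `e2` and `e3`
  -- only the definition of `X.bundle` remains.
  exact (equiv_bwd_fwd hX X.isMorita_proj hqY).symm.trans
    (.bwd hXq hX X.isMorita_proj ((e1.trans e2).trans e3))

/-- Invert q in the relation `fwd_quoHom_bundle`; this is where f must be Morita. -/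
theorem bwd_quoHom_bundle (hAut : IsSmoothManifold (LieAut G)) {X Y : LieExt G} (f : X ⟶ Y)
    (hf : morita G f) : (bwd (quoHom f) X.bundle).Equiv Y.bundle :=
  (Equiv.bwd Y.quo_lie.ofGroupoid X.quo_lie.ofGroupoid (isMorita_quoHom f hf)
    (fwd_quoHom_bundle hAut f).symm).trans
    (equiv_bwd_fwd X.quo_lie.ofGroupoid (isMorita_quoHom f hf) (Y.isGenMor_bundle hAut))

/-- Both directions are carried through the induction on the generated equivalence relation, so that
its symmetry case merely swaps them. -/
theorem MoritaEquiv.exists_isMoritaEquiv (hAut : IsSmoothManifold (LieAut G)) {X Y : LieExt G}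
    (h : X.MoritaEquiv Y) :
    (∃ μ : Zigzag (ofGroupoid Y.quo) (ofGroupoid X.quo), μ.IsMoritaEquiv ∧
      (μ.append X.bundle).Equiv Y.bundle) ∧
    (∃ μ : Zigzag (ofGroupoid X.quo) (ofGroupoid Y.quo), μ.IsMoritaEquiv ∧
      (μ.append Y.bundle).Equiv X.bundle) := by
  have trans : ∀ {X Y Z : LieExt G}
      (_ : ∃ μ : Zigzag (ofGroupoid Y.quo) (ofGroupoid X.quo), μ.IsMoritaEquiv ∧
        (μ.append X.bundle).Equiv Y.bundle)
      (_ : ∃ μ : Zigzag (ofGroupoid Z.quo) (ofGroupoid Y.quo), μ.IsMoritaEquiv ∧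
        (μ.append Y.bundle).Equiv Z.bundle),
      ∃ μ : Zigzag (ofGroupoid Z.quo) (ofGroupoid X.quo), μ.IsMoritaEquiv ∧
        (μ.append X.bundle).Equiv Z.bundle := by
    rintro X Y Z ⟨μ, hμ, e⟩ ⟨μ', hμ', e'⟩
    refine ⟨μ'.append μ, hμ'.append hμ, ?_⟩
    rw [append_assoc]
    exact (Equiv.precomp hμ'.isGenMor e).trans e'
  induction h with
  | rel X Y h =>
    obtain ⟨f, hf⟩ := h
    have hX := X.quo_lie.ofGroupoid
    have hY := Y.quo_lie.ofGroupoid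
    have hq := isMorita_quoHom f hf
    exact ⟨⟨bwd (quoHom f) (nil _), ⟨hY, hq, hX⟩, bwd_quoHom_bundle hAut f hf⟩,
      ⟨fwd (quoHom f) (nil _), ⟨hX, hq, hY⟩, fwd_quoHom_bundle hAut f⟩⟩
  | refl X =>
    have h := Zigzag.Equiv.refl (X.isGenMor_bundle hAut)
    exact ⟨⟨nil _, X.quo_lie.ofGroupoid, h⟩, ⟨nil _, X.quo_lie.ofGroupoid, h⟩⟩
  | symm X Y _ ih => exact ⟨ih.2, ih.1⟩
  | trans X Y Z _ _ ih ih' => exact ⟨trans ih.1 ih'.1, trans ih'.2 ih.2⟩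

end LieExt

/-! ### The category of generalized morphisms and the localized form of part (b). -/

section Localization

/-- The Lie 2-groupoids, as objects of the category of generalized morphisms. -/
structure LieTwoGroupoid where
  carrier : TwoGroupoid.{u}
  isLie : carrier.IsLie

namespace LieTwoGroupoid

/-- Equivalence of generalized morphisms. -/
def genMorSetoid (Γ Δ : LieTwoGroupoid.{u}) :
    Setoid {z : Zigzag Γ.carrier Δ.carrier // z.IsGenMor} where
  r z w := z.1.Equiv w.1
  iseqv := ⟨fun z => .refl z.2, .symm, .trans⟩

/-- The category of Lie 2-groupoids and equivalence classes of generalized morphisms. -/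
instance : Category LieTwoGroupoid.{u} where
  Hom Γ Δ := Quotient (genMorSetoid Γ Δ)
  id Γ := Quotient.mk _ ⟨nil _, Γ.isLie⟩
  comp := Quotient.map₂ (fun z w => ⟨z.1.append w.1, z.2.append w.2⟩)
    fun z _ h _ w' h' => (Equiv.precomp z.2 h').trans (Equiv.postcomp w'.2 h)
  id_comp := by
    rintro _ _ ⟨z⟩
    rfl
  comp_id := by
    rintro _ _ ⟨z⟩
    exact congrArg (Quotient.mk _) (Subtype.ext (append_nil _))
  assoc := by
    rintro _ _ _ _ ⟨z⟩ ⟨w⟩ ⟨v⟩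
    exact congrArg (Quotient.mk _) (Subtype.ext (append_assoc _ _ _))

/-- The class of a generalized morphism. -/
def mkHom {Γ Δ : LieTwoGroupoid.{u}} (z : Zigzag Γ.carrier Δ.carrier) (hz : z.IsGenMor) : Γ ⟶ Δ :=
  Quotient.mk (genMorSetoid Γ Δ) ⟨z, hz⟩

theorem mkHom_surjective {Γ Δ : LieTwoGroupoid.{u}} (a : Γ ⟶ Δ) : ∃ z hz, mkHom z hz = a := by
  obtain ⟨⟨z, hz⟩, rfl⟩ := Quotient.exists_rep a
  exact ⟨z, hz, rfl⟩

theorem mkHom_eq_iff {Γ Δ : LieTwoGroupoid.{u}} {z w : Zigzag Γ.carrier Δ.carrier}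
    {hz : z.IsGenMor} {hw : w.IsGenMor} : mkHom z hz = mkHom w hw ↔ z.Equiv w :=
  ⟨fun h => Quotient.exact h, fun h => Quotient.sound h⟩

theorem isInvertible_of_iso {Γ Δ : LieTwoGroupoid.{u}} (e : Γ ≅ Δ)
    {z : Zigzag Γ.carrier Δ.carrier} (hz : z.IsGenMor) (h : mkHom z hz = e.hom) :
    z.IsInvertible := by
  obtain ⟨w, hw, h'⟩ := mkHom_surjective e.inv
  have h1 : mkHom z hz ≫ mkHom w hw = 𝟙 Γ := by rw [h, h', e.hom_inv_id]
  have h2 : mkHom w hw ≫ mkHom z hz = 𝟙 Δ := by rw [h, h', e.inv_hom_id]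
  exact ⟨hz, w, hw, Quotient.exact h1, Quotient.exact h2⟩

theorem isIso_mkHom_fwd {Γ Δ : LieTwoGroupoid.{u}} {f : TwoGroupoid.Hom Γ.carrier Δ.carrier}
    (hf : f.IsMorita) : IsIso (mkHom (fwd f (nil _)) ⟨Γ.isLie, hf.smooth, Δ.isLie⟩ : Γ ⟶ Δ) :=
  ⟨mkHom (bwd f (nil _)) ⟨Δ.isLie, hf, Γ.isLie⟩,
    mkHom_eq_iff.2 (Equiv.fwd_bwd Γ.isLie Δ.isLie hf),
    mkHom_eq_iff.2 (Equiv.bwd_fwd Γ.isLie Δ.isLie hf)⟩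

end LieTwoGroupoid

open LieTwoGroupoid

namespace LieExt

variable {G : Type u} [Group G] [DiffeologicalSpace G] [IsLieGroup G]

/-- The functor that sends an extension of `Γ` to the corresponding principal bundle over `Γ`. -/
def bundleFunctor (hAut : IsSmoothManifold (LieAut G)) :
    LieExt G ⥤ Over (⟨autTwoGroup G, isLie_autTwoGroup hAut⟩ : LieTwoGroupoid.{u}) where
  obj X := Over.mk (Y := ⟨ofGroupoid X.quo, X.quo_lie.ofGroupoid⟩)
    (mkHom X.bundle (X.isGenMor_bundle hAut))
  map {X Y} f := Over.homMk
    (mkHom (fwd (quoHom f) (nil _))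
      ⟨X.quo_lie.ofGroupoid, isSmooth_quoHom f, Y.quo_lie.ofGroupoid⟩)
    (mkHom_eq_iff.2 (fwd_quoHom_bundle hAut f))
  -- A morphism over the 2-group is determined by its base component, and `quoHom` respects
  -- identities and composites by definition. Functoriality thus reduces to the relations `Equiv.id`
  -- and `Equiv.comp`.
  map_id X := Over.OverMorphism.ext (mkHom_eq_iff.2 (Equiv.id X.quo_lie.ofGroupoid))
  map_comp {X Y Z} f g := Over.OverMorphism.ext (mkHom_eq_iff.2
    (Equiv.comp X.quo_lie.ofGroupoid Y.quo_lie.ofGroupoid Z.quo_lie.ofGroupoid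
      (isSmooth_quoHom f) (isSmooth_quoHom g)).symm)

/-- The forgetful functor from the over category reflects isomorphisms, so it is enough that the
base component q is Morita. -/
theorem isInvertedBy_bundleFunctor (hAut : IsSmoothManifold (LieAut G)) :
    (morita G).IsInvertedBy (bundleFunctor hAut) := by
  intro X Y f hf
  have : IsIso ((Over.forget _).map ((bundleFunctor hAut).map f)) :=
    isIso_mkHom_fwd (isMorita_quoHom f hf)
  exact isIso_of_reflects_iso _ (Over.forget _)

/-- By the universal property the bundle functor extends to the localization, and the extension
agrees with it on objects by definition. -/
theorem LocIso.nonempty_iso (hAut : IsSmoothManifold (LieAut G)) {X Y : LieExt G}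
    (h : X.LocIso Y) : Nonempty ((bundleFunctor hAut).obj X ≅ (bundleFunctor hAut).obj Y) := by
  obtain ⟨e⟩ := h
  have hi := isInvertedBy_bundleFunctor hAut
  exact ⟨(Localization.Construction.lift (bundleFunctor hAut) hi).mapIso e⟩

theorem LocIso.bundleMoritaInv (hAut : IsSmoothManifold (LieAut G)) {X Y : LieExt G}
    (h : X.LocIso Y) : X.bundle.BundleMoritaInv Y.bundle := by
  obtain ⟨e⟩ := h.nonempty_iso hAut
  have hK := isLie_autTwoGroup hAut
  -- The inverse is used because μ goes from the base of `Y` to that of `X`. The commuting triangle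
  -- of `e.inv` over the 2-group is then the required equivalence, with ν the identity.
  obtain ⟨μ, hμ, h⟩ := mkHom_surjective e.inv.left
  refine ⟨μ, nil _, isInvertible_of_iso ((Over.forget _).mapIso e.symm) hμ h,
    ⟨hK, nil _, hK, .refl hK, .refl hK⟩, ?_⟩
  rw [append_nil]
  have hw := Over.w e.inv
  rw [← h] at hw
  exact mkHom_eq_iff.1 hw

theorem MoritaEquiv.bundleMorita (hAut : IsSmoothManifold (LieAut G)) {X Y : LieExt G}
    (h : X.MoritaEquiv Y) : X.bundle.BundleMorita Y.bundle := by
  obtain ⟨⟨μ, hμ, e⟩, -⟩ := h.exists_isMoritaEquiv hAut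
  refine ⟨μ, nil _, hμ, isLie_autTwoGroup hAut, ?_⟩
  rwa [append_nil]

end LieExt

end Localization

end

end LieTwo

theorem proposition3p6 (G : Type u) [Group G] [DiffeologicalSpace G] [LieTwo.IsLieGroup G]
    (hAut : LieTwo.IsSmoothManifold (LieTwo.LieAut G)) :
    (∀ X : LieTwo.LieExt G, X.bundle.IsGenMor) ∧
    (∀ X Y : LieTwo.LieExt G, X.MoritaEquiv Y → X.bundle.BundleMorita Y.bundle) ∧
    (∀ X Y : LieTwo.LieExt G, X.LocIso Y → X.bundle.BundleMoritaInv Y.bundle) :=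
  ⟨fun X => X.isGenMor_bundle hAut, fun _ _ h => h.bundleMorita hAut,
    fun _ _ h => h.bundleMoritaInv hAut⟩
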